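/- All graphs are finite and simple. For a graph $H$ and an integer $k\ge 0$ let $m(H,k)$ be the number of vertices of degree $k$ in $H$, and let $m(H)$ be the maximum number of vertices of the same degree in $H$ (with $m(H)=0$ if $H$ has no vertices). Let $G$ be a cubic (i.e. $3$-regular, not necessarily connected) graph on $n$ vertices that is not isomorphic to $K_4$, to $K_{3,3}$, or to $3K_4$, the disjoint union of three copies of $K_4$. Then $G$ has a spanning subgraph $H$ such that for every $k\in\{0,1,2,3\}$ $$m(H,k)\in\left\{\left\lfloor\frac n4\right\rfloor,\left\lceil\frac n4\right\rceil\right\},$$ and, moreover, $m(H)=\lceil n/4\rceil$. This is optimal: every spanning subgraph $H'$ of $G$ satisfies $m(H')\ge\lceil n/4\rceil$. -/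

import Mathlib

open scoped SimpleGraph

open scoped Classical in
/-- `vertexCount H k` is `m(H, k)`: the number of vertices of degree `k` in `H`. -/
noncomputable def vertexCount {V : Type*} [Fintype V] (H : SimpleGraph V) (k : ℕ) : ℕ :=
  (Finset.univ.filter fun v : V => H.degree v = k).card

open scoped Classical in
/-- `maxVertexCount H` is `m(H)`: the maximum number of vertices of the same degree in `H`
(and `0` for the graph without vertices). -/
noncomputable def maxVertexCount {V : Type*} [Fintype V] (H : SimpleGraph V) : ℕ :=
  Finset.univ.sup fun v : V => vertexCount H (H.degree v)

/-- The complete graph `K₄`. -/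
abbrev graphK4 : SimpleGraph (Fin 4) := ⊤

/-- The complete bipartite graph `K₃,₃`. -/
abbrev graphK33 : SimpleGraph (Fin 3 ⊕ Fin 3) := completeBipartiteGraph (Fin 3) (Fin 3)

/-- The graph `3K₄`: the disjoint union of three copies of `K₄`. -/
abbrev graphThreeK4 : SimpleGraph (Fin 4 ⊕ Fin 4 ⊕ Fin 4) := graphK4 ⊕g (graphK4 ⊕g graphK4)

/-! Describe a spanning subgraph `H` by its degree counts (n0, n1, n2, n3). The number n of vertices
is even, so n = 2q + 2m with m = q or m = q + 1, and the target is (m, q, m, q): its entries are the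
floor and ceiling of n/4. Passing to `G \ H` reverses the counts, so (q, m, q, m) serves as well.
Optimality is the pigeonhole principle.

Connected graphs: call `H` a member of the cone if n0 ≥ m, n1 ≤ q, n2 ≤ m and n3 ≥ q. Inside the
cone, adding or removing a few edges with prescribed end degrees lowers n0 + n3 until the target
appears (`realizes_of_cone`). Such edges exist by double counting (`NonEdgeCounts`, `EdgeCounts`) or
by connectedness. A cone member arises by growing a shortest cycle, or by attaching pendant edges
when that cycle is long (`exists_inCone`).

Disconnected graphs: balanced counts of two parts add up to balanced counts, after a reversal if m =
q + 1 in both. For components K4 and K33 one also needs a subgraph of the rest that is slightly off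
balance (`exists_nearBalanced`), whose defect a subgraph of K4 or K33 repairs. Having both kinds of
subgraph (`IsGood`) survives the addition of components, and the induction over components leaves
only K4, K33, 2K4 and 3K4 outside; 2K4 is balanced directly. -/

/-- The degree of a vertex, computed classically. -/
noncomputable def deg {V : Type*} [Fintype V] (H : SimpleGraph V) (v : V) : ℕ := by
  classical exact H.degree v

set_option linter.unusedSectionVars false

/-! ### Degrees under a change of one edge, and counting of darts. -/

section Basic
open Finset
open scoped Classical
variable {V : Type*} [Fintype V]

theorem deg_eq_card (H : SimpleGraph V) (v : V) :
    deg H v = (univ.filter fun w => H.Adj v w).card := by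
  unfold deg
  rw [← SimpleGraph.card_neighborFinset_eq_degree]
  congr 1
  ext w
  simp

theorem deg_eq_degree (H : SimpleGraph V) (v : V) [Fintype (H.neighborSet v)] :
    deg H v = H.degree v := by
  unfold deg
  congr!

theorem vertexCount_eq (H : SimpleGraph V) (k : ℕ) :
    vertexCount H k = (univ.filter fun v => deg H v = k).card := by
  unfold vertexCount
  congr 1

/-- `K'` is obtained from `K` by adding the edge `uv`. -/
structure AddsEdge (K K' : SimpleGraph V) (u v : V) : Prop where
  not_adj : ¬ K.Adj u v
  adj_iff : ∀ x y, K'.Adj x y ↔ K.Adj x y ∨ (x = u ∧ y = v) ∨ (x = v ∧ y = u)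

namespace AddsEdge
variable {K K' : SimpleGraph V} {u v : V}

theorem symm (h : AddsEdge K K' u v) : AddsEdge K K' v u where
  not_adj := fun h' => h.not_adj h'.symm
  adj_iff := fun x y => by rw [h.adj_iff]; tauto

theorem adj (h : AddsEdge K K' u v) : K'.Adj u v := by
  rw [h.adj_iff]; tauto

theorem ne (h : AddsEdge K K' u v) : u ≠ v := h.adj.ne

theorem deg_left (h : AddsEdge K K' u v) : deg K' u = deg K u + 1 := by
  have : (univ.filter fun w => K'.Adj u w) = insert v (univ.filter fun w => K.Adj u w) := by
    ext w
    have := h.ne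
    simp only [mem_filter, mem_univ, true_and, mem_insert, h.adj_iff]
    tauto
  rw [deg_eq_card, deg_eq_card, this, card_insert_of_notMem]
  simpa using h.not_adj

theorem deg_right (h : AddsEdge K K' u v) : deg K' v = deg K v + 1 := h.symm.deg_left

theorem deg_of_ne (h : AddsEdge K K' u v) {w : V} (hu : w ≠ u) (hv : w ≠ v) :
    deg K' w = deg K w := by
  rw [deg_eq_card, deg_eq_card]
  congr 1
  ext x
  simp only [mem_filter, mem_univ, true_and, h.adj_iff]
  tauto

theorem adj_of_ne (h : AddsEdge K K' u v) {x y : V} (hu : x ≠ u) (hv : x ≠ v) :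
    K'.Adj x y ↔ K.Adj x y := by
  rw [h.adj_iff]; tauto

theorem count (h : AddsEdge K K' u v) (k : ℕ) :
    vertexCount K' k + ((if deg K u = k then 1 else 0) + (if deg K v = k then 1 else 0)) =
    vertexCount K k + ((if deg K u + 1 = k then 1 else 0) + (if deg K v + 1 = k then 1 else 0)) := by
  have key : ∀ (J : SimpleGraph V), vertexCount J k =
      ((univ \ {u, v}).filter fun w => deg J w = k).card +
        ((if deg J u = k then 1 else 0) + (if deg J v = k then 1 else 0)) := by
    intro J
    rw [vertexCount_eq, card_filter, card_filter, ← sum_sdiff (subset_univ {u, v}),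
      sum_pair h.ne]
  rw [key K', key K, h.deg_left, h.deg_right]
  have : ((univ \ {u, v}).filter fun w => deg K' w = k) =
      ((univ \ {u, v}).filter fun w => deg K w = k) := by
    apply filter_congr
    intro w hw
    simp only [mem_sdiff, mem_univ, true_and, mem_insert, mem_singleton, not_or] at hw
    rw [h.deg_of_ne hw.1 hw.2]
  rw [this]
  omega

end AddsEdge

theorem exists_addsEdge {G H : SimpleGraph V} (hH : H ≤ G) {u v : V} (huv : G.Adj u v)
    (hn : ¬ H.Adj u v) : ∃ H' ≤ G, AddsEdge H H' u v := by
  refine ⟨H ⊔ SimpleGraph.edge u v, sup_le hH ?_, hn, ?_⟩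
  · intro x y hxy
    rw [SimpleGraph.edge_adj] at hxy
    rcases hxy.1 with ⟨rfl, rfl⟩ | ⟨rfl, rfl⟩
    · exact huv
    · exact huv.symm
  · intro x y
    have := huv.ne
    rw [SimpleGraph.sup_adj, SimpleGraph.edge_adj]
    constructor
    · tauto
    · rintro (h | ⟨rfl, rfl⟩ | ⟨rfl, rfl⟩)
      · tauto
      · tauto
      · right; exact ⟨by tauto, huv.ne'⟩

theorem exists_removesEdge {G H : SimpleGraph V} (hH : H ≤ G) {u v : V} (huv : H.Adj u v) :
    ∃ H' ≤ G, AddsEdge H' H u v := by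
  refine ⟨H.deleteEdges {s(u, v)}, (SimpleGraph.deleteEdges_le _).trans hH, ?_, ?_⟩
  · simp
  · intro x y
    simp only [SimpleGraph.deleteEdges_adj, Set.mem_singleton_iff, Sym2.eq_iff]
    constructor
    · tauto
    · rintro (h | ⟨rfl, rfl⟩ | ⟨rfl, rfl⟩)
      · exact h.1
      · exact huv
      · exact huv.symm

/-- Number of darts of `K` from a vertex labelled `i` to a vertex labelled `j`. -/
noncomputable def darts (K : SimpleGraph V) (f : V → ℕ) (i j : ℕ) : ℕ :=
  (univ.filter fun p : V × V => K.Adj p.1 p.2 ∧ f p.1 = i ∧ f p.2 = j).card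

theorem darts_comm (K : SimpleGraph V) (f : V → ℕ) (i j : ℕ) : darts K f i j = darts K f j i := by
  unfold darts
  refine card_bij (fun p _ => (p.2, p.1)) ?_ ?_ ?_
  · rintro ⟨a, b⟩ h
    simp only [mem_filter, mem_univ, true_and] at h ⊢
    exact ⟨h.1.symm, h.2.2, h.2.1⟩
  · rintro ⟨a, b⟩ _ ⟨c, d⟩ _ h
    simpa [and_comm] using h
  · rintro ⟨a, b⟩ h
    simp only [mem_filter, mem_univ, true_and] at h
    exact ⟨(b, a), by simp [h.1.symm, h.2.1, h.2.2], rfl⟩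

theorem darts_ne_zero {K : SimpleGraph V} {f : V → ℕ} {i j : ℕ} (h : darts K f i j ≠ 0) :
    ∃ u v, K.Adj u v ∧ f u = i ∧ f v = j := by
  obtain ⟨⟨u, v⟩, hp⟩ := card_pos.mp (Nat.pos_of_ne_zero h)
  simp only [mem_filter, mem_univ, true_and] at hp
  exact ⟨u, v, hp⟩

theorem darts_eq_zero {K : SimpleGraph V} {f : V → ℕ} {i j : ℕ}
    (h : ∀ u v, K.Adj u v → f u = i → f v ≠ j) : darts K f i j = 0 := by
  by_contra h'
  obtain ⟨u, v, h1, h2, h3⟩ := darts_ne_zero h'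
  exact h u v h1 h2 h3

theorem darts_eq_sum (K : SimpleGraph V) (f : V → ℕ) (i j : ℕ) :
    darts K f i j = ∑ u ∈ univ.filter (fun u => f u = i),
      (univ.filter fun v => K.Adj u v ∧ f v = j).card := by
  unfold darts
  rw [card_filter, ← univ_product_univ, sum_product, sum_filter]
  refine sum_congr rfl fun u _ => ?_
  split_ifs with hu
  · rw [card_filter]
    refine sum_congr rfl fun v _ => ?_
    simp [hu]
  · simp [hu]

/-- Double counting of the darts at one label. These row sums are the source of the edges with
prescribed end degrees. -/
theorem darts_row {K : SimpleGraph V} {f : V → ℕ} (hf : ∀ v, f v ≤ 3) {i d : ℕ}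
    (hd : ∀ v, f v = i → deg K v = d) :
    darts K f i 0 + darts K f i 1 + darts K f i 2 + darts K f i 3 =
      d * (univ.filter fun u => f u = i).card := by
  simp only [darts_eq_sum, ← sum_add_distrib]
  rw [mul_comm, ← smul_eq_mul, ← sum_const]
  refine sum_congr rfl fun u hu => ?_
  rw [← hd u (by simpa using hu), deg_eq_card]
  have h : ∀ j, (univ.filter fun v => K.Adj u v ∧ f v = j).card =
      ∑ v ∈ univ.filter (fun v => K.Adj u v), if f v = j then 1 else 0 := by
    intro j
    rw [← card_filter, filter_filter]
  rw [h, h, h, h, ← sum_add_distrib, ← sum_add_distrib, ← sum_add_distrib, card_eq_sum_ones]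
  refine sum_congr rfl fun v _ => ?_
  have := hf v
  interval_cases f v <;> simp

end Basic


/-! ### Spanning subgraphs of cubic graphs: edge types, row sums, complementation. -/

section Cubic
open Finset
open scoped Classical
variable {V : Type*} [Fintype V] {G H : SimpleGraph V}

theorem deg_add_deg {K : SimpleGraph V} {v : V} (h : ∀ w, G.Adj v w ↔ K.Adj v w ∨ H.Adj v w)
    (h' : ∀ w, K.Adj v w → ¬ H.Adj v w) : deg K v + deg H v = deg G v := by
  rw [deg_eq_card, deg_eq_card, deg_eq_card, ← card_union_of_disjoint]
  · congr 1
    ext w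
    simp [h]
  · rw [Finset.disjoint_filter]
    exact fun w _ => h' w

theorem deg_sdiff_add (hH : H ≤ G) (v : V) : deg (G \ H) v + deg H v = deg G v := by
  refine deg_add_deg (fun w => ?_) fun w hw => hw.2
  have := @hH v w
  rw [SimpleGraph.sdiff_adj]
  tauto

theorem deg_le_three (hG : ∀ v, deg G v = 3) (hH : H ≤ G) (v : V) : deg H v ≤ 3 := by
  have := deg_sdiff_add hH v
  have := hG v
  omega

theorem sum_vertexCount (hG : ∀ v, deg G v = 3) (hH : H ≤ G) :
    vertexCount H 0 + vertexCount H 1 + vertexCount H 2 + vertexCount H 3 = Fintype.card V := by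
  simp only [vertexCount_eq, card_filter, ← sum_add_distrib]
  rw [Fintype.card, card_eq_sum_ones]
  refine sum_congr rfl fun v _ => ?_
  have := deg_le_three hG hH v
  interval_cases deg H v <;> simp

theorem vertexCount_pos {v : V} {k : ℕ} (h : deg H v = k) : 0 < vertexCount H k := by
  rw [vertexCount_eq]
  exact card_pos.mpr ⟨v, by simp [h]⟩

theorem exists_of_vertexCount_pos {k : ℕ} (h : 0 < vertexCount H k) : ∃ v, deg H v = k := by
  rw [vertexCount_eq] at h
  obtain ⟨v, hv⟩ := card_pos.mp h
  exact ⟨v, by simpa using hv⟩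

theorem exists_adj_of_deg_pos {v : V} (h : 0 < deg H v) : ∃ w, H.Adj v w := by
  rw [deg_eq_card] at h
  obtain ⟨w, hw⟩ := card_pos.mp h
  exact ⟨w, by simpa using hw⟩

theorem exists_adj_ne_of_deg {v x : V} (h : 1 < deg H v) : ∃ w, H.Adj v w ∧ w ≠ x := by
  rw [deg_eq_card] at h
  obtain ⟨w, hw, hx⟩ := exists_mem_ne h x
  exact ⟨w, by simpa using hw, hx⟩

theorem deg_pos_of_adj {v w : V} (h : H.Adj v w) : 0 < deg H v := by
  rw [deg_eq_card]
  exact card_pos.mpr ⟨w, by simpa using h⟩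

theorem deg_lt_of_not_adj (hG : ∀ v, deg G v = 3) (hH : H ≤ G) {v w : V} (h : G.Adj v w)
    (h' : ¬ H.Adj v w) : deg H v < 3 := by
  have h1 := deg_sdiff_add hH v
  have h2 : 0 < deg (G \ H) v := deg_pos_of_adj (w := w) ⟨h, h'⟩
  have := hG v
  omega

/-- `u` and `v` have degrees `i` and `j` in `H` and are joined by an edge of `G` outside `H`. -/
structure NonEdge (G H : SimpleGraph V) (i j : ℕ) (u v : V) : Prop where
  adj : G.Adj u v
  not_adj : ¬ H.Adj u v
  left : deg H u = i
  right : deg H v = j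

/-- `u` and `v` have degrees `i` and `j` in `H` and are joined by an edge of `H`. -/
structure HEdge (H : SimpleGraph V) (i j : ℕ) (u v : V) : Prop where
  adj : H.Adj u v
  left : deg H u = i
  right : deg H v = j

theorem darts_eq_zero_of_nonEdge {i j : ℕ} (h : ∀ u v, ¬ NonEdge G H i j u v) :
    darts (G \ H) (deg H) i j = 0 :=
  darts_eq_zero fun u v h1 h2 h3 => h u v ⟨h1.1, h1.2, h2, h3⟩

theorem darts_eq_zero_of_hEdge {i j : ℕ} (h : ∀ u v, ¬ HEdge H i j u v) :
    darts H (deg H) i j = 0 :=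
  darts_eq_zero fun u v h1 h2 h3 => h u v ⟨h1, h2, h3⟩

theorem not_nonEdge_of_darts {i j : ℕ} (h : darts (G \ H) (deg H) i j = 0) (u v : V) :
    ¬ NonEdge G H i j u v := fun e =>
  (card_pos.2 ⟨(u, v), by simp [e.adj, e.not_adj, e.left, e.right]⟩ :
    0 < darts (G \ H) (deg H) i j).ne' h

theorem not_hEdge_of_darts {i j : ℕ} (h : darts H (deg H) i j = 0) (u v : V) :
    ¬ HEdge H i j u v := fun e =>
  (card_pos.2 ⟨(u, v), by simp [e.adj, e.left, e.right]⟩ : 0 < darts H (deg H) i j).ne' h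

/-- `eij` counts the edges of `G` outside `H` with ends of `H`-degrees `i` and `j`
(twice if `i = j`). -/
structure NonEdgeCounts (G H : SimpleGraph V) (e00 e01 e02 e11 e12 e22 : ℕ) : Prop where
  row0 : 3 * vertexCount H 0 = e00 + e01 + e02
  row1 : 2 * vertexCount H 1 = e01 + e11 + e12
  row2 : vertexCount H 2 = e02 + e12 + e22
  zero00 : (∀ u v, ¬ NonEdge G H 0 0 u v) → e00 = 0
  zero01 : (∀ u v, ¬ NonEdge G H 0 1 u v) → e01 = 0
  zero02 : (∀ u v, ¬ NonEdge G H 0 2 u v) → e02 = 0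
  zero11 : (∀ u v, ¬ NonEdge G H 1 1 u v) → e11 = 0
  zero12 : (∀ u v, ¬ NonEdge G H 1 2 u v) → e12 = 0
  zero22 : (∀ u v, ¬ NonEdge G H 2 2 u v) → e22 = 0
  darts11 : darts (G \ H) (deg H) 1 1 = e11
  not_nonEdge00 : e00 = 0 → ∀ u v, ¬ NonEdge G H 0 0 u v

/-- `fij` counts the edges of `H` with ends of `H`-degrees `i` and `j` (twice if `i = j`). -/
structure EdgeCounts (H : SimpleGraph V) (f11 f12 f13 f22 f23 f33 : ℕ) : Prop where
  row1 : vertexCount H 1 = f11 + f12 + f13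
  row2 : 2 * vertexCount H 2 = f12 + f22 + f23
  row3 : 3 * vertexCount H 3 = f13 + f23 + f33
  zero11 : (∀ u v, ¬ HEdge H 1 1 u v) → f11 = 0
  zero12 : (∀ u v, ¬ HEdge H 1 2 u v) → f12 = 0
  zero13 : (∀ u v, ¬ HEdge H 1 3 u v) → f13 = 0
  zero22 : (∀ u v, ¬ HEdge H 2 2 u v) → f22 = 0
  zero23 : (∀ u v, ¬ HEdge H 2 3 u v) → f23 = 0
  zero33 : (∀ u v, ¬ HEdge H 3 3 u v) → f33 = 0
  not_hEdge33 : f33 = 0 → ∀ u v, ¬ HEdge H 3 3 u v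

theorem exists_nonEdgeCounts (hG : ∀ v, deg G v = 3) (hH : H ≤ G) :
    ∃ e00 e01 e02 e11 e12 e22 : ℕ, NonEdgeCounts G H e00 e01 e02 e11 e12 e22 := by
  refine ⟨_, _, _, _, _, _, ?_, ?_, ?_, darts_eq_zero_of_nonEdge, darts_eq_zero_of_nonEdge,
    darts_eq_zero_of_nonEdge, darts_eq_zero_of_nonEdge, darts_eq_zero_of_nonEdge,
    darts_eq_zero_of_nonEdge, rfl, not_nonEdge_of_darts⟩
  all_goals
    have hf := deg_le_three hG hH
    -- A vertex of degree three in `H` has no edge of `G` left outside `H`, so the rows have no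
    -- fourth term.
    have h3 : ∀ i, darts (G \ H) (deg H) i 3 = 0 := fun i => darts_eq_zero fun u v huv _ hv => by
      have := deg_lt_of_not_adj hG hH huv.symm.1 huv.symm.2
      omega
    have hr : ∀ i ≤ 3, ∀ v, deg H v = i → deg (G \ H) v = 3 - i := fun i _ v hv => by
      have := deg_sdiff_add hH v
      have := hG v
      omega
    have r0 := darts_row hf (hr 0 (by omega))
    have r1 := darts_row hf (hr 1 (by omega))
    have r2 := darts_row hf (hr 2 (by omega))
    rw [← vertexCount_eq, h3] at r0 r1 r2
    have c01 := darts_comm (G \ H) (deg H) 0 1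
    have c02 := darts_comm (G \ H) (deg H) 0 2
    have c12 := darts_comm (G \ H) (deg H) 1 2
    omega

theorem exists_edgeCounts (hG : ∀ v, deg G v = 3) (hH : H ≤ G) :
    ∃ f11 f12 f13 f22 f23 f33 : ℕ, EdgeCounts H f11 f12 f13 f22 f23 f33 := by
  refine ⟨_, _, _, _, _, _, ?_, ?_, ?_, darts_eq_zero_of_hEdge, darts_eq_zero_of_hEdge,
    darts_eq_zero_of_hEdge, darts_eq_zero_of_hEdge, darts_eq_zero_of_hEdge,
    darts_eq_zero_of_hEdge, not_hEdge_of_darts⟩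
  all_goals
    have hf := deg_le_three hG hH
    have h0 : ∀ i, darts H (deg H) i 0 = 0 := fun i => darts_eq_zero fun u v huv _ hv => by
      have := deg_pos_of_adj huv.symm
      omega
    have r1 := darts_row hf (i := 1) (fun v hv => hv)
    have r2 := darts_row hf (i := 2) (fun v hv => hv)
    have r3 := darts_row hf (i := 3) (fun v hv => hv)
    rw [← vertexCount_eq, h0] at r1 r2 r3
    have c13 := darts_comm H (deg H) 1 3
    have c12 := darts_comm H (deg H) 1 2
    have c23 := darts_comm H (deg H) 2 3
    omega

theorem even_odd_count (hG : ∀ v, deg G v = 3) (hH : H ≤ G) :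
    Even (vertexCount H 1 + vertexCount H 3) := by
  have h := H.even_card_odd_degree_vertices
  have e : (univ.filter fun v => Odd (H.degree v)).card = vertexCount H 1 + vertexCount H 3 := by
    rw [vertexCount_eq, vertexCount_eq, card_filter, card_filter, card_filter, ← sum_add_distrib]
    refine sum_congr rfl fun v _ => ?_
    rw [← deg_eq_degree]
    have := deg_le_three hG hH v
    interval_cases deg H v <;> (simp; try decide)
  rwa [e] at h

/-- Some spanning subgraph of `G` has `a`, `b`, `c`, `d` vertices of degree `0`, `1`, `2`, `3`. -/
def Realizes (G : SimpleGraph V) (a b c d : ℕ) : Prop :=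
  ∃ H ≤ G, vertexCount H 0 = a ∧ vertexCount H 1 = b ∧ vertexCount H 2 = c ∧ vertexCount H 3 = d

theorem vertexCount_sdiff (hG : ∀ v, deg G v = 3) (hH : H ≤ G) {k l : ℕ} (hkl : k + l = 3) :
    vertexCount (G \ H) k = vertexCount H l := by
  rw [vertexCount_eq, vertexCount_eq]
  congr 1
  ext v
  have := deg_sdiff_add hH v
  have := hG v
  simp only [mem_filter, mem_univ, true_and]
  omega

/-- Complementation within `G` is the symmetry that saves half of the case analysis. -/
theorem Realizes.reverse (hG : ∀ v, deg G v = 3) {a b c d : ℕ} (h : Realizes G a b c d) :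
    Realizes G d c b a := by
  obtain ⟨H, hH, h0, h1, h2, h3⟩ := h
  exact ⟨G \ H, sdiff_le, (vertexCount_sdiff hG hH rfl).trans h3,
    (vertexCount_sdiff hG hH rfl).trans h2, (vertexCount_sdiff hG hH rfl).trans h1,
    (vertexCount_sdiff hG hH rfl).trans h0⟩

theorem AddsEdge.counts {K K' : SimpleGraph V} {u v : V} (h : AddsEdge K K' u v) {i j : ℕ}
    (hu : deg K u = i) (hv : deg K v = j) :
    (vertexCount K' 0 + ((if i = 0 then 1 else 0) + (if j = 0 then 1 else 0)) =
      vertexCount K 0) ∧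
    (vertexCount K' 1 + ((if i = 1 then 1 else 0) + (if j = 1 then 1 else 0)) =
      vertexCount K 1 + ((if i = 0 then 1 else 0) + (if j = 0 then 1 else 0))) ∧
    (vertexCount K' 2 + ((if i = 2 then 1 else 0) + (if j = 2 then 1 else 0)) =
      vertexCount K 2 + ((if i = 1 then 1 else 0) + (if j = 1 then 1 else 0))) ∧
    (vertexCount K' 3 + ((if i = 3 then 1 else 0) + (if j = 3 then 1 else 0)) =
      vertexCount K 3 + ((if i = 2 then 1 else 0) + (if j = 2 then 1 else 0))) := by
  subst hu hv
  refine ⟨?_, ?_, ?_, ?_⟩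
  · simpa using h.count 0
  · simpa using h.count 1
  · simpa using h.count 2
  · simpa using h.count 3

/-- Adding a non-edge of `H`. -/
theorem NonEdge.add {i j : ℕ} {u v : V} (h : NonEdge G H i j u v) (hH : H ≤ G) :
    ∃ H' ≤ G, AddsEdge H H' u v ∧ deg H' u = i + 1 ∧ deg H' v = j + 1 ∧
    (vertexCount H' 0 + ((if i = 0 then 1 else 0) + (if j = 0 then 1 else 0)) =
      vertexCount H 0) ∧
    (vertexCount H' 1 + ((if i = 1 then 1 else 0) + (if j = 1 then 1 else 0)) =
      vertexCount H 1 + ((if i = 0 then 1 else 0) + (if j = 0 then 1 else 0))) ∧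
    (vertexCount H' 2 + ((if i = 2 then 1 else 0) + (if j = 2 then 1 else 0)) =
      vertexCount H 2 + ((if i = 1 then 1 else 0) + (if j = 1 then 1 else 0))) ∧
    (vertexCount H' 3 + ((if i = 3 then 1 else 0) + (if j = 3 then 1 else 0)) =
      vertexCount H 3 + ((if i = 2 then 1 else 0) + (if j = 2 then 1 else 0))) := by
  obtain ⟨H', hH', h'⟩ := exists_addsEdge hH h.adj h.not_adj
  exact ⟨H', hH', h', by rw [h'.deg_left, h.left], by rw [h'.deg_right, h.right],
    h'.counts h.left h.right⟩

/-- Removing an edge of `H`. -/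
theorem HEdge.remove {i j : ℕ} {u v : V} (h : HEdge H (i + 1) (j + 1) u v) (hH : H ≤ G) :
    ∃ H' ≤ G, AddsEdge H' H u v ∧ deg H' u = i ∧ deg H' v = j ∧
    (vertexCount H 0 + ((if i = 0 then 1 else 0) + (if j = 0 then 1 else 0)) =
      vertexCount H' 0) ∧
    (vertexCount H 1 + ((if i = 1 then 1 else 0) + (if j = 1 then 1 else 0)) =
      vertexCount H' 1 + ((if i = 0 then 1 else 0) + (if j = 0 then 1 else 0))) ∧
    (vertexCount H 2 + ((if i = 2 then 1 else 0) + (if j = 2 then 1 else 0)) =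
      vertexCount H' 2 + ((if i = 1 then 1 else 0) + (if j = 1 then 1 else 0))) ∧
    (vertexCount H 3 + ((if i = 3 then 1 else 0) + (if j = 3 then 1 else 0)) =
      vertexCount H' 3 + ((if i = 2 then 1 else 0) + (if j = 2 then 1 else 0))) := by
  obtain ⟨H', hH', h'⟩ := exists_removesEdge hH h.adj
  have hu : deg H' u = i := by have := h'.deg_left; have := h.left; omega
  have hv : deg H' v = j := by have := h'.deg_right; have := h.right; omega
  exact ⟨H', hH', h', hu, hv, h'.counts hu hv⟩

theorem NonEdge.symm {i j : ℕ} {u v : V} (h : NonEdge G H i j u v) : NonEdge G H j i v u :=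
  ⟨h.adj.symm, fun h' => h.not_adj h'.symm, h.right, h.left⟩

theorem HEdge.symm {i j : ℕ} {u v : V} (h : HEdge H i j u v) : HEdge H j i v u :=
  ⟨h.adj.symm, h.right, h.left⟩

/-- Edges and non-edges away from a changed edge are unaffected. -/
theorem AddsEdge.nonEdge_iff {K K' : SimpleGraph V} {u v x y : V} {i j : ℕ}
    (h : AddsEdge K K' u v) (hxu : x ≠ u) (hxv : x ≠ v) (hyu : y ≠ u) (hyv : y ≠ v) :
    NonEdge G K' i j x y ↔ NonEdge G K i j x y := by
  constructor
  · rintro ⟨h1, h2, h3, h4⟩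
    exact ⟨h1, by rwa [h.adj_of_ne hxu hxv] at h2, by rwa [h.deg_of_ne hxu hxv] at h3,
      by rwa [h.deg_of_ne hyu hyv] at h4⟩
  · rintro ⟨h1, h2, h3, h4⟩
    exact ⟨h1, by rwa [h.adj_of_ne hxu hxv], by rwa [h.deg_of_ne hxu hxv],
      by rwa [h.deg_of_ne hyu hyv]⟩

theorem AddsEdge.hEdge_iff {K K' : SimpleGraph V} {u v x y : V} {i j : ℕ}
    (h : AddsEdge K K' u v) (hxu : x ≠ u) (hxv : x ≠ v) (hyu : y ≠ u) (hyv : y ≠ v) :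
    HEdge K' i j x y ↔ HEdge K i j x y := by
  constructor
  · rintro ⟨h1, h2, h3⟩
    exact ⟨by rwa [h.adj_of_ne hxu hxv] at h1, by rwa [h.deg_of_ne hxu hxv] at h2,
      by rwa [h.deg_of_ne hyu hyv] at h3⟩
  · rintro ⟨h1, h2, h3⟩
    exact ⟨by rwa [h.adj_of_ne hxu hxv], by rwa [h.deg_of_ne hxu hxv],
      by rwa [h.deg_of_ne hyu hyv]⟩

end Cubic


/-! ### Moves: adding and removing paths and pairs of edges. -/

section Moves
open Finset
open scoped Classical
variable {V : Type*} [Fintype V] {G H : SimpleGraph V}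

theorem ne_of_deg_ne {a b : V} (h : deg H a ≠ deg H b) : a ≠ b := fun e => h (e ▸ rfl)

theorem NonEdge.ne {i j : ℕ} {u v : V} (h : NonEdge G H i j u v) : u ≠ v := h.adj.ne

theorem HEdge.ne {i j : ℕ} {u v : V} (h : HEdge H i j u v) : u ≠ v := h.adj.ne

theorem AddsEdge.nonEdge_add {K K' : SimpleGraph V} {u v y : V} {i j : ℕ}
    (h : AddsEdge K K' u v) (hy : NonEdge G K i j u y) (hv : y ≠ v) :
    NonEdge G K' (i + 1) j u y := by
  have := hy.ne
  refine ⟨hy.adj, ?_, by rw [h.deg_left, hy.left], by rw [h.deg_of_ne hy.ne.symm hv, hy.right]⟩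
  rw [h.adj_iff]
  have := hy.not_adj
  tauto

theorem AddsEdge.hEdge_add {K K' : SimpleGraph V} {u v y : V} {i j : ℕ}
    (h : AddsEdge K K' u v) (hy : HEdge K i j u y) : HEdge K' (i + 1) j u y := by
  have hv : y ≠ v := fun e => h.not_adj (e ▸ hy.adj)
  refine ⟨?_, by rw [h.deg_left, hy.left], by rw [h.deg_of_ne hy.ne.symm hv, hy.right]⟩
  rw [h.adj_iff]
  exact Or.inl hy.adj

theorem AddsEdge.hEdge_remove {K K' : SimpleGraph V} {u v y : V} {i j : ℕ}
    (h : AddsEdge K K' u v) (hy : HEdge K' (i + 1) j u y) (hv : y ≠ v) :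
    HEdge K i j u y := by
  have h1 := h.deg_left
  have h2 := hy.left
  refine ⟨?_, by omega, by rw [← h.deg_of_ne hy.ne.symm hv, hy.right]⟩
  have h3 := hy.adj
  have := hy.ne
  rw [h.adj_iff] at h3
  tauto

/-- This is how connectedness enters: if certain edge types do not occur, some class of vertices
cannot be left. -/
theorem mem_of_closed (hc : G.Preconnected) {p : V → Prop} {x : V} (hx : p x)
    (h : ∀ x y, p x → G.Adj x y → p y) (y : V) : p y := by
  obtain ⟨w⟩ := hc x y
  induction w with
  | nil => exact hx
  | cons hadj _ ih => exact ih (h _ _ hx hadj)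

theorem NonEdge.of_sdiff (hG : ∀ v, deg G v = 3) (hH : H ≤ G) {i j k l : ℕ} {u v : V}
    (h : NonEdge G (G \ H) i j u v) (hk : i + k = 3) (hl : j + l = 3) : HEdge H k l u v := by
  have h1 := deg_sdiff_add hH u
  have h2 := deg_sdiff_add hH v
  have h3 := hG u
  have h4 := hG v
  have h5 := h.left
  have h6 := h.right
  refine ⟨?_, by omega, by omega⟩
  by_contra h'
  exact h.not_adj ⟨h.adj, h'⟩

/-- A vertex isolated in `H` is joined, in `G`, to vertices of `H`-degree at most two. -/
theorem nonEdge_of_deg_zero (hG : ∀ v, deg G v = 3) (hH : H ≤ G) {x y : V}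
    (hx : deg H x = 0) (hxy : G.Adj x y) :
    NonEdge G H 0 0 x y ∨ NonEdge G H 0 1 x y ∨ NonEdge G H 0 2 x y := by
  have hn : ¬ H.Adj x y := fun h => by
    have := deg_pos_of_adj h
    omega
  have h3 := deg_lt_of_not_adj hG hH hxy.symm (fun h => hn h.symm)
  have : deg H y = 0 ∨ deg H y = 1 ∨ deg H y = 2 := by omega
  rcases this with h | h | h
  · exact Or.inl ⟨hxy, hn, hx, h⟩
  · exact Or.inr (Or.inl ⟨hxy, hn, hx, h⟩)
  · exact Or.inr (Or.inr ⟨hxy, hn, hx, h⟩)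

/-- Double counting gives an edge of `G` between isolated vertices. If no such edge continued to
degree two, the isolated vertices with an isolated neighbour would be closed under adjacency,
against `z`. -/
theorem exists_path_zero_zero_two (hG : ∀ v, deg G v = 3) (hH : H ≤ G) (hc : G.Preconnected)
    (h01 : ∀ u v, ¬ NonEdge G H 0 1 u v) (hlt : vertexCount H 2 < 3 * vertexCount H 0)
    {z : V} (hz : deg H z ≠ 0) :
    ∃ w x y, NonEdge G H 0 0 w x ∧ NonEdge G H 0 2 x y := by
  by_contra hno
  push Not at hno
  have h00 : ∃ u v, NonEdge G H 0 0 u v := by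
    by_contra hn
    push Not at hn
    obtain ⟨e00, e01, e02, e11, e12, e22, E⟩ := exists_nonEdgeCounts hG hH
    have := E.row0
    have := E.row2
    have := E.zero01 h01
    have := E.zero00 hn
    omega
  obtain ⟨u, v, huv⟩ := h00
  refine hz (mem_of_closed (p := fun a => ∃ b, NonEdge G H 0 0 a b) hc ⟨v, huv⟩ ?_ z).choose_spec.left
  rintro x y ⟨b, hb⟩ hxy
  rcases nonEdge_of_deg_zero hG hH hb.left hxy with h | h | h
  · exact ⟨x, h.symm⟩
  · exact absurd h (h01 _ _)
  · exact absurd h (hno b x y hb.symm)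

theorem exists_path_three_three_one (hG : ∀ v, deg G v = 3) (hH : H ≤ G) (hc : G.Preconnected)
    (h23 : ∀ u v, ¬ HEdge H 2 3 u v) (hlt : vertexCount H 1 < 3 * vertexCount H 3)
    {z : V} (hz : deg H z ≠ 3) :
    ∃ w x y, HEdge H 3 3 w x ∧ HEdge H 3 1 x y := by
  have hz' : deg (G \ H) z ≠ 0 := by
    have := deg_sdiff_add hH z
    have := hG z
    omega
  have e1 := vertexCount_sdiff hG hH (k := 2) (l := 1) rfl
  have e2 := vertexCount_sdiff hG hH (k := 0) (l := 3) rfl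
  obtain ⟨w, x, y, h1, h2⟩ := exists_path_zero_zero_two (H := G \ H) hG sdiff_le hc
    (fun u v h => h23 v u (h.of_sdiff hG hH rfl rfl).symm) (by omega) hz'
  exact ⟨w, x, y, h1.of_sdiff hG hH rfl rfl, h2.of_sdiff hG hH rfl rfl⟩

/-- The path takes the degrees 0, 0, 2 to 1, 2, 3. Edges between vertices of odd degree avoid it, so
a removal among them can follow. -/
theorem add_path_zero_zero_two (hH : H ≤ G) {w x y : V}
    (h1 : NonEdge G H 0 0 w x) (h2 : NonEdge G H 0 2 x y) :
    ∃ H' ≤ G, vertexCount H' 0 + 2 = vertexCount H 0 ∧ vertexCount H' 1 = vertexCount H 1 + 1 ∧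
      vertexCount H' 2 = vertexCount H 2 ∧ vertexCount H' 3 = vertexCount H 3 + 1 ∧
      ∀ i j a b, (i = 1 ∨ i = 3) → (j = 1 ∨ j = 3) → HEdge H i j a b → HEdge H' i j a b := by
  obtain ⟨H1, hH1, hadd, -, -, hk⟩ := h1.symm.add hH
  have hyw : y ≠ w := ne_of_deg_ne (H := H) (by rw [h2.right, h1.left]; decide)
  obtain ⟨H2, hH2, hadd2, -, -, hk2⟩ := (hadd.nonEdge_add h2 hyw).add hH1
  simp at hk hk2
  refine ⟨H2, hH2, by omega, by omega, by omega, by omega, ?_⟩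
  intro i j a b hi hj hab
  have ha := hab.left
  have hb := hab.right
  have e1 := h1.left
  have e2 := h1.right
  have e3 := h2.right
  have k1 : a ≠ w := ne_of_deg_ne (H := H) (by omega)
  have k2 : a ≠ x := ne_of_deg_ne (H := H) (by omega)
  have k3 : a ≠ y := ne_of_deg_ne (H := H) (by omega)
  have k4 : b ≠ w := ne_of_deg_ne (H := H) (by omega)
  have k5 : b ≠ x := ne_of_deg_ne (H := H) (by omega)
  have k6 : b ≠ y := ne_of_deg_ne (H := H) (by omega)
  rw [hadd2.hEdge_iff k2 k3 k5 k6, hadd.hEdge_iff k2 k1 k5 k4]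
  exact hab

theorem remove_path_three_three_one (hH : H ≤ G) {w x y : V}
    (h1 : HEdge H 3 3 w x) (h2 : HEdge H 3 1 x y) :
    ∃ H' ≤ G, vertexCount H' 0 = vertexCount H 0 + 1 ∧ vertexCount H' 1 = vertexCount H 1 ∧
      vertexCount H' 2 = vertexCount H 2 + 1 ∧ vertexCount H' 3 + 2 = vertexCount H 3 := by
  obtain ⟨H1, hH1, hadd, -, -, hk⟩ := h1.symm.remove hH
  have hyw : y ≠ w := ne_of_deg_ne (H := H) (by rw [h2.right, h1.left]; decide)
  obtain ⟨H2, hH2, hadd2, -, -, hk2⟩ := (hadd.hEdge_remove h2 hyw).remove hH1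
  simp at hk hk2
  exact ⟨H2, hH2, by omega, by omega, by omega, by omega⟩

theorem ne_of_deg {a b : V} {i j : ℕ} (ha : deg H a = i) (hb : deg H b = j) (hij : i ≠ j) :
    a ≠ b :=
  ne_of_deg_ne (by rw [ha, hb]; exact hij)

/-- The inequalities between degrees make the two edges disjoint, so that their effects simply add.
-/
theorem NonEdge.add_add {i j k l : ℕ} {u v x y : V} (h : NonEdge G H i j u v)
    (h' : NonEdge G H k l x y) (hH : H ≤ G) (h1 : k ≠ i) (h2 : k ≠ j) (h3 : l ≠ i) (h4 : l ≠ j) :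
    ∃ H' ≤ G, ∀ n, vertexCount H' n + ((if i = n then 1 else 0) + (if j = n then 1 else 0) +
      ((if k = n then 1 else 0) + (if l = n then 1 else 0))) =
      vertexCount H n + ((if i + 1 = n then 1 else 0) + (if j + 1 = n then 1 else 0) +
      ((if k + 1 = n then 1 else 0) + (if l + 1 = n then 1 else 0))) := by
  obtain ⟨H1, hH1, a1, -⟩ := h.add hH
  have h'' := (a1.nonEdge_iff (ne_of_deg h'.left h.left h1) (ne_of_deg h'.left h.right h2)
    (ne_of_deg h'.right h.left h3) (ne_of_deg h'.right h.right h4)).2 h'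
  obtain ⟨H2, hH2, a2, -⟩ := h''.add hH1
  refine ⟨H2, hH2, fun n => ?_⟩
  have k1 := a1.count n
  have k2 := a2.count n
  rw [h.left, h.right] at k1
  rw [h''.left, h''.right] at k2
  omega

theorem NonEdge.add_remove {i j k l : ℕ} {u v x y : V} (h : NonEdge G H i j u v)
    (h' : HEdge H (k + 1) (l + 1) x y) (hH : H ≤ G) (h1 : k + 1 ≠ i) (h2 : k + 1 ≠ j)
    (h3 : l + 1 ≠ i) (h4 : l + 1 ≠ j) :
    ∃ H' ≤ G, ∀ n, vertexCount H' n + ((if i = n then 1 else 0) + (if j = n then 1 else 0) +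
      ((if k + 1 = n then 1 else 0) + (if l + 1 = n then 1 else 0))) =
      vertexCount H n + ((if i + 1 = n then 1 else 0) + (if j + 1 = n then 1 else 0) +
      ((if k = n then 1 else 0) + (if l = n then 1 else 0))) := by
  obtain ⟨H1, hH1, a1, -⟩ := h.add hH
  have h'' := (a1.hEdge_iff (ne_of_deg h'.left h.left h1) (ne_of_deg h'.left h.right h2)
    (ne_of_deg h'.right h.left h3) (ne_of_deg h'.right h.right h4)).2 h'
  obtain ⟨H2, hH2, a2, d1, d2, -⟩ := h''.remove hH1
  refine ⟨H2, hH2, fun n => ?_⟩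
  have k1 := a1.count n
  have k2 := a2.count n
  rw [h.left, h.right] at k1
  rw [d1, d2] at k2
  omega

theorem HEdge.remove_remove {i j k l : ℕ} {u v x y : V} (h : HEdge H (i + 1) (j + 1) u v)
    (h' : HEdge H (k + 1) (l + 1) x y) (hH : H ≤ G) (h1 : k ≠ i) (h2 : k ≠ j)
    (h3 : l ≠ i) (h4 : l ≠ j) :
    ∃ H' ≤ G, ∀ n, vertexCount H' n + ((if i + 1 = n then 1 else 0) +
      (if j + 1 = n then 1 else 0) +
      ((if k + 1 = n then 1 else 0) + (if l + 1 = n then 1 else 0))) =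
      vertexCount H n + ((if i = n then 1 else 0) + (if j = n then 1 else 0) +
      ((if k = n then 1 else 0) + (if l = n then 1 else 0))) := by
  obtain ⟨H1, hH1, a1, d1, d2, -⟩ := h.remove hH
  have h'' := (a1.hEdge_iff (ne_of_deg h'.left h.left (by omega))
    (ne_of_deg h'.left h.right (by omega)) (ne_of_deg h'.right h.left (by omega))
    (ne_of_deg h'.right h.right (by omega))).1 h'
  obtain ⟨H2, hH2, a2, d3, d4, -⟩ := h''.remove hH1
  refine ⟨H2, hH2, fun n => ?_⟩
  have k1 := a1.count n
  have k2 := a2.count n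
  rw [d1, d2] at k1
  rw [d3, d4] at k2
  omega

end Moves


/-! ### The last step to balance when one degree is in excess. -/

section Descent
open Finset
open scoped Classical
variable {V : Type*} [Fintype V] {G H : SimpleGraph V}

/-- Number of darts with given ends is at least three when two `1`-`1` darts do not suffice. -/
theorem exists_other_nonEdge {i : ℕ} {y w : V} (h : 2 < darts (G \ H) (deg H) i i) :
    ∃ p r, NonEdge G H i i p r ∧ ¬ (p = y ∧ r = w) ∧ ¬ (p = w ∧ r = y) := by
  by_contra hno
  push Not at hno
  have : darts (G \ H) (deg H) i i ≤ ({(y, w), (w, y)} : Finset (V × V)).card := by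
    unfold darts
    apply card_le_card
    rintro ⟨p, r⟩ hp
    simp only [mem_filter, mem_univ, true_and] at hp
    have := hno p r ⟨hp.1.1, hp.1.2, hp.2.1, hp.2.2⟩
    simp only [mem_insert, mem_singleton, Prod.mk.injEq]
    tauto
  have := this.trans (card_insert_le _ _)
  simp at this
  omega

/-- Add a `0`-`0` edge and move along an alternating path joining vertices of degree one. -/
theorem realizes_of_alternating_one (hH : H ≤ G) {x x' y w z : V} (hx : NonEdge G H 0 0 x x')
    (hy : NonEdge G H 1 1 y w) (hz : HEdge H 1 1 y z) :
    ∃ H' ≤ G, vertexCount H' 0 + 1 = vertexCount H 0 ∧ vertexCount H' 1 = vertexCount H 1 ∧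
      vertexCount H' 2 = vertexCount H 2 + 1 ∧ vertexCount H' 3 = vertexCount H 3 := by
  have hzw : z ≠ w := fun e => hy.not_adj (e ▸ hz.adj)
  obtain ⟨H1, hH1, a1, -, -, k1⟩ := hx.add hH
  have n1 : y ≠ x := ne_of_deg hy.left hx.left (by decide)
  have n2 : y ≠ x' := ne_of_deg hy.left hx.right (by decide)
  have n3 : w ≠ x := ne_of_deg hy.right hx.left (by decide)
  have n4 : w ≠ x' := ne_of_deg hy.right hx.right (by decide)
  have n5 : z ≠ x := ne_of_deg hz.right hx.left (by decide)
  have n6 : z ≠ x' := ne_of_deg hz.right hx.right (by decide)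
  obtain ⟨H2, hH2, a2, -, -, k2⟩ := ((a1.nonEdge_iff n1 n2 n3 n4).2 hy).add hH1
  obtain ⟨H3, hH3, a3, -, -, k3⟩ :=
    (a2.hEdge_add ((a1.hEdge_iff n1 n2 n5 n6).2 hz)).remove hH2
  simp at k1 k2 k3
  exact ⟨H3, hH3, by omega, by omega, by omega, by omega⟩

/-- The edges xx', pr, yz are pairwise disjoint. Adding the first two and removing the third changes
the counts by (−2, 2, 0, 0), (0, −2, 2, 0) and (1, 0, −1, 0). -/
theorem realizes_of_one_two (hH : H ≤ G) {x x' p r y z : V} (hx : NonEdge G H 0 0 x x')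
    (hp : NonEdge G H 1 1 p r) (hy : HEdge H 1 2 y z) (h1 : p ≠ y) (h2 : r ≠ y) :
    ∃ H' ≤ G, vertexCount H' 0 + 1 = vertexCount H 0 ∧ vertexCount H' 1 = vertexCount H 1 ∧
      vertexCount H' 2 = vertexCount H 2 + 1 ∧ vertexCount H' 3 = vertexCount H 3 := by
  obtain ⟨H1, hH1, a1, -, -, k1⟩ := hx.add hH
  have n1 : y ≠ x := ne_of_deg hy.left hx.left (by decide)
  have n2 : y ≠ x' := ne_of_deg hy.left hx.right (by decide)
  have n3 : z ≠ x := ne_of_deg hy.right hx.left (by decide)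
  have n4 : z ≠ x' := ne_of_deg hy.right hx.right (by decide)
  have n5 : p ≠ x := ne_of_deg hp.left hx.left (by decide)
  have n6 : p ≠ x' := ne_of_deg hp.left hx.right (by decide)
  have n7 : r ≠ x := ne_of_deg hp.right hx.left (by decide)
  have n8 : r ≠ x' := ne_of_deg hp.right hx.right (by decide)
  have n9 : z ≠ p := ne_of_deg hy.right hp.left (by decide)
  have n10 : z ≠ r := ne_of_deg hy.right hp.right (by decide)
  obtain ⟨H2, hH2, a2, -, -, k2⟩ := ((a1.nonEdge_iff n5 n6 n7 n8).2 hp).add hH1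
  obtain ⟨H3, hH3, a3, -, -, k3⟩ := ((a2.hEdge_iff h1.symm h2.symm n9 n10).2
    ((a1.hEdge_iff n1 n2 n3 n4).2 hy)).remove hH2
  simp at k1 k2 k3
  exact ⟨H3, hH3, by omega, by omega, by omega, by omega⟩

/-- With one isolated vertex too many and one vertex of degree two too few. -/
theorem realizes_of_excess_zero (hG : ∀ v, deg G v = 3) (hc : G.Preconnected) (hH : H ≤ G) {q : ℕ}
    (h0 : vertexCount H 0 = q + 1) (h1 : vertexCount H 1 = q) (h2 : vertexCount H 2 + 1 = q)
    (h3 : vertexCount H 3 = q) : Realizes G q q q q := by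
  by_cases h01 : ∃ u v, NonEdge G H 0 1 u v
  · obtain ⟨u, v, h⟩ := h01
    obtain ⟨H1, hH1, -, -, -, k⟩ := h.add hH
    simp at k
    exact ⟨H1, hH1, by omega, by omega, by omega, by omega⟩
  push Not at h01
  obtain ⟨z, hz⟩ := exists_of_vertexCount_pos (show 0 < vertexCount H 1 by omega)
  obtain ⟨w, x, y, hwx, hxy⟩ := exists_path_zero_zero_two hG hH hc h01 (by omega)
    (show deg H z ≠ 0 by omega)
  by_cases h13 : ∃ u v, HEdge H 1 3 u v
  · obtain ⟨u, v, h⟩ := h13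
    obtain ⟨H1, hH1, c0, c1, c2, c3, hp⟩ := add_path_zero_zero_two hH hwx hxy
    obtain ⟨H2, hH2, -, -, -, k⟩ := (hp 1 3 u v (by simp) (by simp) h).remove hH1
    simp at k
    exact ⟨H2, hH2, by omega, by omega, by omega, by omega⟩
  push Not at h13
  -- Without 0-1 edges outside `H`, e11 = 2q − e12 ≥ 2q − (q − 1).
  have hd : q < darts (G \ H) (deg H) 1 1 := by
    obtain ⟨e00, e01, e02, e11, e12, e22, E⟩ := exists_nonEdgeCounts hG hH
    have := E.row1
    have := E.row2
    have := E.zero01 h01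
    rw [E.darts11]
    omega
  obtain ⟨y1, w1, h11⟩ : ∃ u v, NonEdge G H 1 1 u v := by
    by_contra hn
    push Not at hn
    have := darts_eq_zero_of_nonEdge hn
    omega
  have nbr : ∀ v, deg H v = 1 → ∃ z, HEdge H 1 1 v z ∨ HEdge H 1 2 v z := by
    intro v hv
    obtain ⟨z, hz⟩ := exists_adj_of_deg_pos (show 0 < deg H v by omega)
    have l1 := deg_le_three hG hH z
    have l2 := deg_pos_of_adj hz.symm
    have l3 : deg H z ≠ 3 := fun h => h13 v z ⟨hz, hv, h⟩
    have : deg H z = 1 ∨ deg H z = 2 := by omega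
    exact ⟨z, this.imp (fun h => ⟨hz, hv, h⟩) fun h => ⟨hz, hv, h⟩⟩
  have conclude : (∃ H' ≤ G, vertexCount H' 0 + 1 = vertexCount H 0 ∧
      vertexCount H' 1 = vertexCount H 1 ∧ vertexCount H' 2 = vertexCount H 2 + 1 ∧
      vertexCount H' 3 = vertexCount H 3) → Realizes G q q q q := by
    rintro ⟨H', hH', c0, c1, c2, c3⟩
    exact ⟨H', hH', by omega, by omega, by omega, by omega⟩
  apply conclude
  obtain ⟨y2, hy2 | hy2⟩ := nbr y1 h11.left
  · exact realizes_of_alternating_one hH hwx h11 hy2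
  obtain ⟨w2, hw2 | hw2⟩ := nbr w1 h11.right
  · exact realizes_of_alternating_one hH hwx h11.symm hw2
  have hq : 1 < q := by
    rw [← h1, vertexCount_eq, one_lt_card]
    exact ⟨y1, by simp [h11.left], w1, by simp [h11.right], h11.ne⟩
  -- More than q ≥ 2 darts give a second missing 1-1 edge. It avoids an end of the first one, and
  -- the 1-2 edge at that end is removed.
  obtain ⟨p, r, hpr, hn1, hn2⟩ :=
    exists_other_nonEdge (G := G) (H := H) (i := 1) (y := y1) (w := w1) (by omega)
  by_cases hm : p ≠ y1 ∧ r ≠ y1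
  · exact realizes_of_one_two hH hwx hpr hy2 hm.1 hm.2
  · have := hpr.ne
    have := h11.ne
    refine realizes_of_one_two hH hwx hpr hw2 ?_ ?_ <;> rintro rfl <;> tauto

/-- Here m = q + 1. Either n3 drops and n1 rises by one, or the reversed target is reached instead.
-/
theorem realizes_of_excess_three (hG : ∀ v, deg G v = 3) (hc : G.Preconnected) (hH : H ≤ G)
    {q : ℕ} (h0 : vertexCount H 0 = q + 1) (h1 : vertexCount H 1 + 1 = q)
    (h2 : vertexCount H 2 = q + 1) (h3 : vertexCount H 3 = q + 1) :
    Realizes G (q + 1) q (q + 1) q := by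
  obtain ⟨z, hz⟩ := exists_of_vertexCount_pos (show 0 < vertexCount H 2 by omega)
  by_cases h23 : ∃ u v, HEdge H 2 3 u v
  · obtain ⟨u, v, h⟩ := h23
    obtain ⟨H1, hH1, -, -, -, k⟩ := h.remove hH
    simp at k
    exact ⟨H1, hH1, by omega, by omega, by omega, by omega⟩
  push Not at h23
  by_cases h02 : ∃ u v, NonEdge G H 0 2 u v
  · obtain ⟨u, v, h⟩ := h02
    obtain ⟨H1, hH1, a1, -, -, k⟩ := h.add hH
    simp at k
    obtain ⟨w, x, y, hwx, hxy⟩ := exists_path_three_three_one hG hH hc h23 (by omega)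
      (show deg H z ≠ 3 by omega)
    have n1 : w ≠ u := ne_of_deg hwx.left h.left (by decide)
    have n2 : w ≠ v := ne_of_deg hwx.left h.right (by decide)
    have n3 : x ≠ u := ne_of_deg hwx.right h.left (by decide)
    have n4 : x ≠ v := ne_of_deg hwx.right h.right (by decide)
    have n5 : y ≠ u := ne_of_deg hxy.right h.left (by decide)
    have n6 : y ≠ v := ne_of_deg hxy.right h.right (by decide)
    obtain ⟨H2, hH2, c0, c1, c2, c3⟩ := remove_path_three_three_one hH1
      ((a1.hEdge_iff n1 n2 n3 n4).2 hwx) ((a1.hEdge_iff n3 n4 n5 n6).2 hxy)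
    exact ⟨H2, hH2, by omega, by omega, by omega, by omega⟩
  push Not at h02
  -- The reversed target needs the change (−1, 2, −1, 0): add 0-0 and remove 1-2, or add 0-1 and
  -- remove 2-2.
  apply Realizes.reverse hG
  by_cases h12 : ∃ u v, HEdge H 1 2 u v
  · obtain ⟨u, v, h⟩ := h12
    obtain ⟨x, y, hxy⟩ : ∃ u v, NonEdge G H 0 0 u v := by
      by_contra hn
      push Not at hn
      obtain ⟨e00, e01, e02, e11, e12, e22, E⟩ := exists_nonEdgeCounts hG hH
      have := E.row0
      have := E.row1
      have := E.zero00 hn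
      have := E.zero02 h02
      omega
    obtain ⟨H', hH', k⟩ := hxy.add_remove h hH (by simp) (by simp) (by simp) (by simp)
    have k0 := k 0
    have k1 := k 1
    have k2 := k 2
    have k3 := k 3
    simp at k0 k1 k2 k3
    exact ⟨H', hH', by omega, by omega, by omega, by omega⟩
  push Not at h12
  obtain ⟨u, v, h⟩ : ∃ u v, HEdge H 2 2 u v := by
    by_contra hn
    push Not at hn
    obtain ⟨f11, f12, f13, f22, f23, f33, F⟩ := exists_edgeCounts hG hH
    have := F.row2
    have := F.zero22 hn
    have := F.zero12 h12
    have := F.zero23 h23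
    omega
  have h01 : ∃ x y, NonEdge G H 0 1 x y := by
    by_contra hno
    push Not at hno
    obtain ⟨a, ha⟩ := exists_of_vertexCount_pos (show 0 < vertexCount H 0 by omega)
    have := mem_of_closed (p := fun a => deg H a = 0) hc ha (fun x y hx hxy => by
      rcases nonEdge_of_deg_zero hG hH hx hxy with h | h | h
      · exact h.right
      · exact absurd h (hno _ _)
      · exact absurd h (h02 _ _)) z
    omega
  obtain ⟨x, y, hxy⟩ := h01
  obtain ⟨H', hH', k⟩ := hxy.add_remove h hH (by simp) (by simp) (by simp) (by simp)
  have k0 := k 0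
  have k1 := k 1
  have k2 := k 2
  have k3 := k 3
  simp at k0 k1 k2 k3
  exact ⟨H', hH', by omega, by omega, by omega, by omega⟩

end Descent


/-! ### Descent inside the cone, and perturbations of a balanced subgraph. -/

section Cone
open Finset
open scoped Classical
variable {V : Type*} [Fintype V] {G H : SimpleGraph V}

/-- The added path contributes (−2, 1, 0, 1) and the removed one (1, 0, 1, −2). The latter has only
vertices of odd degree, hence survives the first move. -/
theorem realizes_of_excess_zero_three (hG : ∀ v, deg G v = 3) (hc : G.Preconnected) (hH : H ≤ G)
    {q m : ℕ} (h0 : vertexCount H 0 = m + 1) (h1 : vertexCount H 1 + 1 = q)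
    (h2 : vertexCount H 2 + 1 = m) (h3 : vertexCount H 3 = q + 1)
    (h01 : ∀ u v, ¬ NonEdge G H 0 1 u v) (h23 : ∀ u v, ¬ HEdge H 2 3 u v) :
    Realizes G m q m q := by
  obtain ⟨z, hz⟩ := exists_of_vertexCount_pos (show 0 < vertexCount H 0 by omega)
  obtain ⟨z', hz'⟩ := exists_of_vertexCount_pos (show 0 < vertexCount H 3 by omega)
  obtain ⟨w, x, y, hwx, hxy⟩ := exists_path_zero_zero_two hG hH hc h01 (by omega)
    (show deg H z' ≠ 0 by omega)
  obtain ⟨a, b, c, hab, hbc⟩ := exists_path_three_three_one hG hH hc h23 (by omega)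
    (show deg H z ≠ 3 by omega)
  obtain ⟨H1, hH1, c0, c1, c2, c3, hp⟩ := add_path_zero_zero_two hH hwx hxy
  obtain ⟨H2, hH2, d0, d1, d2, d3⟩ := remove_path_three_three_one hH1
    (hp 3 3 a b (by simp) (by simp) hab) (hp 3 1 b c (by simp) (by simp) hbc)
  exact ⟨H2, hH2, by omega, by omega, by omega, by omega⟩

/-- A spanning subgraph with enough vertices of degrees `0` and `3` can be balanced. -/
theorem realizes_of_cone (hG : ∀ v, deg G v = 3) (hc : G.Preconnected) {q m : ℕ}
    (hm : m = q ∨ m = q + 1) (hcard : Fintype.card V = 2 * q + 2 * m) (hq : 0 < q) (N : ℕ) :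
    ∀ H ≤ G, m ≤ vertexCount H 0 → vertexCount H 1 ≤ q → vertexCount H 2 ≤ m →
      q ≤ vertexCount H 3 → vertexCount H 0 + vertexCount H 3 ≤ N + m + q →
      Realizes G m q m q := by
  induction N with
  | zero =>
    intro H hH h0 h1 h2 h3 hN
    have := sum_vertexCount hG hH
    exact ⟨H, hH, by omega, by omega, by omega, by omega⟩
  | succ N ih =>
    intro H hH h0 h1 h2 h3 hN
    have hs := sum_vertexCount hG hH
    obtain ⟨t, ht⟩ := even_odd_count hG hH
    by_cases hD1 : m + 2 ≤ vertexCount H 0 ∧ vertexCount H 1 + 2 ≤ q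
    · obtain ⟨u, v, h⟩ : ∃ u v, NonEdge G H 0 0 u v := by
        by_contra hn
        push Not at hn
        obtain ⟨e00, e01, e02, e11, e12, e22, E⟩ := exists_nonEdgeCounts hG hH
        have := E.row0
        have := E.row1
        have := E.row2
        have := E.zero00 hn
        omega
      obtain ⟨H1, hH1, -, -, -, k⟩ := h.add hH
      simp at k
      exact ih H1 hH1 (by omega) (by omega) (by omega) (by omega) (by omega)
    by_cases hD2 : q + 2 ≤ vertexCount H 3 ∧ vertexCount H 2 + 2 ≤ m
    · obtain ⟨u, v, h⟩ : ∃ u v, HEdge H 3 3 u v := by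
        by_contra hn
        push Not at hn
        obtain ⟨f11, f12, f13, f22, f23, f33, F⟩ := exists_edgeCounts hG hH
        have := F.row1
        have := F.row2
        have := F.row3
        have := F.zero33 hn
        omega
      obtain ⟨H1, hH1, -, -, -, k⟩ := h.remove hH
      simp at k
      exact ih H1 hH1 (by omega) (by omega) (by omega) (by omega) (by omega)
    by_cases h01 : vertexCount H 2 + 1 ≤ m ∧ m + 1 ≤ vertexCount H 0 ∧ ∃ u v, NonEdge G H 0 1 u v
    · obtain ⟨_, _, u, v, h⟩ := h01
      obtain ⟨H1, hH1, -, -, -, k⟩ := h.add hH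
      simp at k
      exact ih H1 hH1 (by omega) (by omega) (by omega) (by omega) (by omega)
    by_cases h23 : vertexCount H 1 + 1 ≤ q ∧ q + 1 ≤ vertexCount H 3 ∧ ∃ u v, HEdge H 2 3 u v
    · obtain ⟨_, _, u, v, h⟩ := h23
      obtain ⟨H1, hH1, -, -, -, k⟩ := h.remove hH
      simp at k
      exact ih H1 hH1 (by omega) (by omega) (by omega) (by omega) (by omega)
    -- The failure of the first case gives n1 ≥ q − 1, hence n2 < m, so no 0-1 edge is missing.
    by_cases hD3 : m + 2 ≤ vertexCount H 0
    · have h01' : ∀ u v, ¬ NonEdge G H 0 1 u v := fun u v h => h01 ⟨by omega, by omega, u, v, h⟩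
      by_cases hb : vertexCount H 1 = q
      · obtain ⟨u, v, h⟩ : ∃ u v, NonEdge G H 0 0 u v := by
          by_contra hn
          push Not at hn
          obtain ⟨e00, e01, e02, e11, e12, e22, E⟩ := exists_nonEdgeCounts hG hH
          have := E.row0
          have := E.row2
          have := E.zero00 hn
          have := E.zero01 h01'
          omega
        obtain ⟨x, y, h'⟩ : ∃ u v, NonEdge G H 1 1 u v := by
          by_contra hn
          push Not at hn
          obtain ⟨e00, e01, e02, e11, e12, e22, E⟩ := exists_nonEdgeCounts hG hH
          have := E.row1
          have := E.row2
          have := E.zero11 hn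
          have := E.zero01 h01'
          omega
        obtain ⟨H1, hH1, k⟩ := h.add_add h' hH (by simp) (by simp) (by simp) (by simp)
        have k0 := k 0
        have k1 := k 1
        have k2 := k 2
        have k3 := k 3
        simp at k0 k1 k2 k3
        exact ih H1 hH1 (by omega) (by omega) (by omega) (by omega) (by omega)
      · obtain ⟨z, hz⟩ := exists_of_vertexCount_pos (show 0 < vertexCount H 3 by omega)
        obtain ⟨w, x, y, hwx, hxy⟩ := exists_path_zero_zero_two hG hH hc h01' (by omega)
          (show deg H z ≠ 0 by omega)
        obtain ⟨H1, hH1, c0, c1, c2, c3, -⟩ := add_path_zero_zero_two hH hwx hxy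
        exact ih H1 hH1 (by omega) (by omega) (by omega) (by omega) (by omega)
    -- Now n0 ≤ m + 1 and n2 ≥ m − 1, so parity forces n0 + n2 = 2m. Hence n1 + n3 = 2q and n1 ≤ q −
    -- 2.
    by_cases hD4 : q + 2 ≤ vertexCount H 3
    · have h23' : ∀ u v, ¬ HEdge H 2 3 u v := fun u v h => h23 ⟨by omega, by omega, u, v, h⟩
      obtain ⟨u, v, h⟩ : ∃ u v, HEdge H 3 3 u v := by
        by_contra hn
        push Not at hn
        obtain ⟨f11, f12, f13, f22, f23, f33, F⟩ := exists_edgeCounts hG hH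
        have := F.row1
        have := F.row3
        have := F.zero33 hn
        have := F.zero23 h23'
        omega
      obtain ⟨x, y, h'⟩ : ∃ u v, HEdge H 2 2 u v := by
        by_contra hn
        push Not at hn
        obtain ⟨f11, f12, f13, f22, f23, f33, F⟩ := exists_edgeCounts hG hH
        have := F.row1
        have := F.row2
        have := F.zero22 hn
        have := F.zero23 h23'
        omega
      obtain ⟨H1, hH1, k⟩ := h.remove_remove h' hH (by simp) (by simp) (by simp) (by simp)
      have k0 := k 0
      have k1 := k 1
      have k2 := k 2
      have k3 := k 3
      simp at k0 k1 k2 k3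
      exact ih H1 hH1 (by omega) (by omega) (by omega) (by omega) (by omega)
    -- The excesses of n0 and n3 are now at most one, and with them parity determines n1 and n2.
    by_cases hS0 : vertexCount H 0 = m
    · by_cases hS : vertexCount H 3 = q
      · exact ⟨H, hH, by omega, by omega, by omega, by omega⟩
      · rcases hm with rfl | rfl
        · apply Realizes.reverse hG
          exact realizes_of_excess_zero hG hc sdiff_le
            (by rw [vertexCount_sdiff hG hH (l := 3) rfl]; omega)
            (by rw [vertexCount_sdiff hG hH (l := 2) rfl]; omega)
            (by rw [vertexCount_sdiff hG hH (l := 1) rfl]; omega)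
            (by rw [vertexCount_sdiff hG hH (l := 0) rfl]; omega)
        · exact realizes_of_excess_three hG hc hH (by omega) (by omega) (by omega) (by omega)
    · have h01' : ∀ u v, ¬ NonEdge G H 0 1 u v := fun u v h => h01 ⟨by omega, by omega, u, v, h⟩
      by_cases hS : vertexCount H 3 = q
      · rcases hm with rfl | rfl
        · exact realizes_of_excess_zero hG hc hH (by omega) (by omega) (by omega) (by omega)
        · obtain ⟨z, hz⟩ := exists_of_vertexCount_pos (show 0 < vertexCount H 3 by omega)
          obtain ⟨w, x, y, hwx, hxy⟩ := exists_path_zero_zero_two hG hH hc h01' (by omega)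
            (show deg H z ≠ 0 by omega)
          obtain ⟨H1, hH1, c0, c1, c2, c3, -⟩ := add_path_zero_zero_two hH hwx hxy
          -- With m = q + 1 the added path leads to (q, q + 1, q, q + 1).
          exact Realizes.reverse hG ⟨H1, hH1, by omega, by omega, by omega, by omega⟩
      · exact realizes_of_excess_zero_three hG hc hH (by omega) (by omega) (by omega) (by omega)
          h01' fun u v h => h23 ⟨by omega, by omega, u, v, h⟩

/-- The degree sequences obtained from the balanced one by one of five small perturbations. -/
def NearBalanced (q m a b c d : ℕ) : Prop :=
  (a = m + 1 ∧ b = q ∧ c + 1 = m ∧ d = q) ∨ (a = m ∧ b + 1 = q ∧ c = m ∧ d = q + 1) ∨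
  (a = m + 1 ∧ b + 1 = q ∧ c + 1 = m ∧ d = q + 1) ∨
  (a = m + 1 ∧ b = q + 1 ∧ c + 1 = m ∧ d + 1 = q) ∨
  (a + 1 = m ∧ b + 1 = q ∧ c = m + 1 ∧ d = q + 1)

/-- Most edge types, alone or in pairs, give a move into one of the five patterns. If no move is
possible, too few edge types remain for `G` to be connected. -/
theorem exists_nearBalanced (hG : ∀ v, deg G v = 3) (hc : G.Preconnected) {q m : ℕ}
    (hm : m = q ∨ m = q + 1) (hq : 0 < q) (hr : Realizes G m q m q) :
    ∃ a b c d, Realizes G a b c d ∧ NearBalanced q m a b c d := by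
  obtain ⟨H, hH, h0, h1, h2, h3⟩ := hr
  have finish : ∀ H' ≤ G, NearBalanced q m (vertexCount H' 0) (vertexCount H' 1)
      (vertexCount H' 2) (vertexCount H' 3) →
      ∃ a b c d, Realizes G a b c d ∧ NearBalanced q m a b c d :=
    fun H' hH' h => ⟨_, _, _, _, ⟨H', hH', rfl, rfl, rfl, rfl⟩, h⟩
  by_cases t12 : ∃ u v, HEdge H 1 2 u v
  · obtain ⟨u, v, h⟩ := t12
    obtain ⟨H1, hH1, -, -, -, k⟩ := h.remove hH
    simp at k
    exact finish H1 hH1 (by unfold NearBalanced; omega)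
  by_cases s12 : ∃ u v, NonEdge G H 1 2 u v
  · obtain ⟨u, v, h⟩ := s12
    obtain ⟨H1, hH1, -, -, -, k⟩ := h.add hH
    simp at k
    exact finish H1 hH1 (by unfold NearBalanced; omega)
  push Not at t12 s12
  have hadj : ∀ x y, G.Adj x y → (∃ i j, HEdge H (i + 1) (j + 1) x y ∧ i + 1 ≤ 3 ∧ j + 1 ≤ 3) ∨
      ∃ i j, NonEdge G H i j x y ∧ i ≤ 2 ∧ j ≤ 2 := by
    intro x y hxy
    by_cases h : H.Adj x y
    · obtain ⟨i, hi⟩ := Nat.exists_eq_add_one.2 (deg_pos_of_adj h)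
      obtain ⟨j, hj⟩ := Nat.exists_eq_add_one.2 (deg_pos_of_adj h.symm)
      exact Or.inl ⟨i, j, ⟨h, hi, hj⟩, hi ▸ deg_le_three hG hH x, hj ▸ deg_le_three hG hH y⟩
    · exact Or.inr ⟨_, _, ⟨hxy, h, rfl, rfl⟩, Nat.le_of_lt_succ (deg_lt_of_not_adj hG hH hxy h),
        Nat.le_of_lt_succ (deg_lt_of_not_adj hG hH hxy.symm fun h' => h h'.symm)⟩
  have no02_11 : ∀ {o w u v}, NonEdge G H 0 2 o w → HEdge H 1 1 u v →
      ∃ a b c d, Realizes G a b c d ∧ NearBalanced q m a b c d := by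
    intro o w u v h h'
    obtain ⟨H1, hH1, k⟩ := h.add_remove h' hH (by simp) (by simp) (by simp) (by simp)
    have k0 := k 0
    have k1 := k 1
    have k2 := k 2
    have k3 := k 3
    simp at k0 k1 k2 k3
    exact finish H1 hH1 (by unfold NearBalanced; omega)
  obtain ⟨z1, hz1⟩ := exists_of_vertexCount_pos (show 0 < vertexCount H 1 by omega)
  obtain ⟨z2, hz2⟩ := exists_of_vertexCount_pos (show 0 < vertexCount H 2 by omega)
  -- Without 1-3 edges, a vertex of degree one has its `H`-neighbour in degree one. If moreover no
  -- 0-2 edge is missing, degrees two and three form a closed class.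
  by_cases t13 : ∀ u v, ¬ HEdge H 1 3 u v
  · by_cases s02 : ∃ u v, NonEdge G H 0 2 u v
    · obtain ⟨o, w, h⟩ := s02
      obtain ⟨y, hy⟩ := exists_adj_of_deg_pos (show 0 < deg H z1 by omega)
      have l1 := deg_le_three hG hH y
      have l2 := deg_pos_of_adj hy.symm
      have l3 : deg H y ≠ 3 := fun h => t13 _ _ ⟨hy, hz1, h⟩
      have l4 : deg H y ≠ 2 := fun h => t12 _ _ ⟨hy, hz1, h⟩
      exact no02_11 h ⟨hy, hz1, by omega⟩
    · push Not at s02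
      have := mem_of_closed (p := fun v => deg H v = 2 ∨ deg H v = 3) hc (Or.inl hz2) ?_ z1
      · omega
      intro x y hx hxy
      rcases hadj x y hxy with ⟨i, j, h, hi, hj⟩ | ⟨i, j, h, hi, hj⟩
      · have := h.left
        have := h.right
        have : j ≠ 0 := by
          rintro rfl
          rcases hx with hx | hx
          · exact t12 y x ⟨h.adj.symm, h.right, hx⟩
          · exact t13 y x ⟨h.adj.symm, h.right, hx⟩
        omega
      · have := h.left
        have := h.right
        obtain rfl : i = 2 := by omega
        have : j ≠ 0 := by
          rintro rfl
          exact s02 y x h.symm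
        have : j ≠ 1 := by
          rintro rfl
          exact s12 y x h.symm
        omega
  push Not at t13
  obtain ⟨u, v, huv⟩ := t13
  by_cases t22 : ∃ u v, HEdge H 2 2 u v
  · obtain ⟨x, y, h⟩ := t22
    obtain ⟨H1, hH1, k⟩ := huv.remove_remove h hH (by simp) (by simp) (by simp) (by simp)
    have k0 := k 0
    have k1 := k 1
    have k2 := k 2
    have k3 := k 3
    simp at k0 k1 k2 k3
    exact finish H1 hH1 (by unfold NearBalanced; omega)
  by_cases s22 : ∃ u v, NonEdge G H 2 2 u v
  · obtain ⟨x, y, h⟩ := s22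
    obtain ⟨H1, hH1, k⟩ := h.add_remove huv hH (by simp) (by simp) (by simp) (by simp)
    have k0 := k 0
    have k1 := k 1
    have k2 := k 2
    have k3 := k 3
    simp at k0 k1 k2 k3
    exact finish H1 hH1 (by unfold NearBalanced; omega)
  push Not at t22 s22
  obtain ⟨o, w, how⟩ : ∃ u v, NonEdge G H 0 2 u v := by
    by_contra hn
    push Not at hn
    obtain ⟨e00, e01, e02, e11, e12, e22, E⟩ := exists_nonEdgeCounts hG hH
    have := E.row2
    have := E.zero02 hn
    have := E.zero12 s12
    have := E.zero22 s22
    omega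
  by_cases t11 : ∃ u v, HEdge H 1 1 u v
  · obtain ⟨x, y, h⟩ := t11
    exact no02_11 how h
  by_cases s11 : ∃ u v, NonEdge G H 1 1 u v
  · obtain ⟨x, y, h⟩ := s11
    obtain ⟨H1, hH1, k⟩ := how.add_add h hH (by simp) (by simp) (by simp) (by simp)
    have k0 := k 0
    have k1 := k 1
    have k2 := k 2
    have k3 := k 3
    simp at k0 k1 k2 k3
    exact finish H1 hH1 (by unfold NearBalanced; omega)
  push Not at t11 s11
  -- The row sums give e00 = 2(m − q) and f33 = 2(q − m); neither is negative, so both vanish.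
  have key : (∀ u v, ¬ HEdge H 3 3 u v) ∧ ∀ u v, ¬ NonEdge G H 0 0 u v := by
    obtain ⟨e00, e01, e02, e11, e12, e22, E⟩ := exists_nonEdgeCounts hG hH
    obtain ⟨f11, f12, f13, f22, f23, f33, F⟩ := exists_edgeCounts hG hH
    have := E.row0
    have := E.row1
    have := E.row2
    have := E.zero11 s11
    have := E.zero12 s12
    have := E.zero22 s22
    have := F.row1
    have := F.row2
    have := F.row3
    have := F.zero11 t11
    have := F.zero12 t12
    have := F.zero22 t22
    exact ⟨F.not_hEdge33 (by omega), E.not_nonEdge00 (by omega)⟩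
  by_cases A : ∃ d c x, HEdge H 3 1 d c ∧ HEdge H 3 2 d x
  · obtain ⟨d, c, x, h, h'⟩ := A
    obtain ⟨H1, hH1, a1, -, -, k⟩ := h.remove hH
    obtain ⟨H2, hH2, a2, -, -, k'⟩ :=
      (a1.hEdge_remove h' (ne_of_deg h'.right h.right (by simp))).remove hH1
    simp at k k'
    exact finish H2 hH2 (by unfold NearBalanced; omega)
  by_cases B : ∃ d c x, NonEdge G H 0 1 d c ∧ NonEdge G H 0 2 d x
  · obtain ⟨d, c, x, h, h'⟩ := B
    obtain ⟨H1, hH1, a1, -, -, k⟩ := h.add hH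
    obtain ⟨H2, hH2, a2, -, -, k'⟩ :=
      (a1.nonEdge_add h' (ne_of_deg h'.right h.right (by simp))).add hH1
    simp at k k'
    exact finish H2 hH2 (by unfold NearBalanced; omega)
  push Not at A B
  exfalso
  -- A vertex of degree three or zero with a neighbour of degree one now has only such neighbours,
  -- so this class never reaches degree two.
  have := mem_of_closed (p := fun v => deg H v = 1 ∨ (∃ c, HEdge H 3 1 v c) ∨
    ∃ c, NonEdge G H 0 1 v c) hc (Or.inl hz1) ?_ z2
  · rcases this with h | ⟨c, h⟩ | ⟨c, h⟩
    · omega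
    · have := h.left; omega
    · have := h.left; omega
  rintro x y (hx | ⟨c, hx⟩ | ⟨c, hx⟩) hxy
  · rcases hadj x y hxy with ⟨i, j, h, hi, hj⟩ | ⟨i, j, h, hi, hj⟩
    · obtain rfl : i = 0 := by have := h.left; omega
      have : j = 0 ∨ j = 1 ∨ j = 2 := by omega
      rcases this with rfl | rfl | rfl
      · exact absurd h (t11 _ _)
      · exact absurd h (t12 _ _)
      · exact Or.inr (Or.inl ⟨x, h.symm⟩)
    · obtain rfl : i = 1 := by have := h.left; omega
      have : j = 0 ∨ j = 1 ∨ j = 2 := by omega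
      rcases this with rfl | rfl | rfl
      · exact Or.inr (Or.inr ⟨x, h.symm⟩)
      · exact absurd h (s11 _ _)
      · exact absurd h (s12 _ _)
  · have hx3 := hx.left
    rcases hadj x y hxy with ⟨i, j, h, hi, hj⟩ | ⟨i, j, h, hi, hj⟩
    · obtain rfl : i = 2 := by have := h.left; omega
      have : j = 0 ∨ j = 1 ∨ j = 2 := by omega
      rcases this with rfl | rfl | rfl
      · exact Or.inl h.right
      · exact absurd h (A _ _ _ hx)
      · exact absurd h (key.1 _ _)
    · have := h.left; omega
  · rcases nonEdge_of_deg_zero hG hH hx.left hxy with h | h | h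
    · exact absurd h (key.2 _ _)
    · exact Or.inl h.right
    · exact absurd h (B _ _ _ hx)

end Cone


/-! ### Shortest cycles by minimality. -/

section Entry
open Finset
open scoped Classical
variable {V : Type*} [Fintype V] {G H : SimpleGraph V}

/-- Twice the number of edges, in terms of the degree counts. -/
noncomputable def weight (H : SimpleGraph V) : ℕ :=
  vertexCount H 1 + 2 * vertexCount H 2 + 3 * vertexCount H 3

/-- `H` has the fewest edges among the nonempty spanning subgraphs of `G` with at least as many
vertices of degree `3` as of degree `1`; it turns out to be a shortest cycle. -/
structure IsShortest (G H : SimpleGraph V) : Prop where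
  le : H ≤ G
  count_le : vertexCount H 1 ≤ vertexCount H 3
  pos : 0 < weight H
  min : ∀ H' ≤ G, vertexCount H' 1 ≤ vertexCount H' 3 → 0 < weight H' → weight H ≤ weight H'

theorem exists_isShortest (hG : ∀ v, deg G v = 3) (hV : 0 < Fintype.card V) :
    ∃ H, IsShortest G H := by
  have hex : ∃ w, ∃ H ≤ G, vertexCount H 1 ≤ vertexCount H 3 ∧ 0 < weight H ∧ weight H = w := by
    have hn : ∀ k, k ≠ 3 → vertexCount G k = 0 := fun k hk => by
      by_contra h
      obtain ⟨v, hv⟩ := exists_of_vertexCount_pos (Nat.pos_of_ne_zero h)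
      exact hk (hv.symm.trans (hG v))
    have := sum_vertexCount hG le_rfl
    have h0 := hn 0 (by simp)
    have h1 := hn 1 (by simp)
    have h2 := hn 2 (by simp)
    exact ⟨_, G, le_rfl, by omega, by unfold weight; omega, rfl⟩
  obtain ⟨H, hH, h1, h2, h3⟩ := Nat.find_spec hex
  exact ⟨H, hH, h1, h2, fun H' hH' h1' h2' => h3 ▸ Nat.find_min' hex ⟨H', hH', h1', h2', rfl⟩⟩

namespace IsShortest

theorem of_weight_le (h : IsShortest G H) {H' : SimpleGraph V} (hH' : H' ≤ G)
    (h1 : vertexCount H' 1 ≤ vertexCount H' 3) (h2 : 0 < weight H')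
    (h3 : weight H' ≤ weight H) : IsShortest G H' :=
  ⟨hH', h1, h2, fun K hK h4 h5 => h3.trans (h.min K hK h4 h5)⟩

/-- Deleting the edge at a vertex of degree one would keep n1 ≤ n3 and leave a smaller nonempty
competitor. -/
theorem count_one (hG : ∀ v, deg G v = 3) (h : IsShortest G H) : vertexCount H 1 = 0 := by
  by_contra h1
  obtain ⟨y, hy⟩ := exists_of_vertexCount_pos (Nat.pos_of_ne_zero h1)
  obtain ⟨z, hz⟩ := exists_adj_of_deg_pos (show 0 < deg H y by omega)
  have l1 := deg_le_three hG h.le z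
  have l2 := deg_pos_of_adj hz.symm
  have hle := h.count_le
  have e : HEdge H (0 + 1) ((deg H z - 1) + 1) y z := ⟨hz, hy, by omega⟩
  obtain ⟨H1, hH1, -, -, -, k⟩ := e.remove h.le
  have hcase : deg H z = 1 ∨ deg H z = 2 ∨ deg H z = 3 := by omega
  have := h.min H1 hH1
  unfold weight at this
  rcases hcase with hd | hd | hd <;> simp [hd] at k <;>
    exact absurd (this (by omega) (by omega)) (by omega)

/-- As n1 = 0, parity gives n3 ≥ 2, so an edge at a vertex of degree three could be deleted while
keeping n1 ≤ n3. -/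
theorem count_three (hG : ∀ v, deg G v = 3) (h : IsShortest G H) : vertexCount H 3 = 0 := by
  by_contra h3
  obtain ⟨x, hx⟩ := exists_of_vertexCount_pos (Nat.pos_of_ne_zero h3)
  obtain ⟨z, hz⟩ := exists_adj_of_deg_pos (show 0 < deg H x by omega)
  have l1 := deg_le_three hG h.le z
  have l2 := deg_pos_of_adj hz.symm
  have h1 := h.count_one hG
  obtain ⟨t, ht⟩ := even_odd_count hG h.le
  have l3 : deg H z ≠ 1 := fun e => by
    have := vertexCount_pos e
    omega
  have e : HEdge H (2 + 1) ((deg H z - 1) + 1) x z := ⟨hz, hx, by omega⟩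
  obtain ⟨H1, hH1, -, -, -, k⟩ := e.remove h.le
  have hcase : deg H z = 2 ∨ deg H z = 3 := by omega
  have := h.min H1 hH1
  unfold weight at this
  rcases hcase with hd | hd <;> simp [hd] at k <;>
    exact absurd (this (by omega) (by omega)) (by omega)

theorem weight_eq (hG : ∀ v, deg G v = 3) (h : IsShortest G H) :
    weight H = 2 * vertexCount H 2 := by
  have := h.count_one hG
  have := h.count_three hG
  unfold weight
  omega

theorem deg_eq (hG : ∀ v, deg G v = 3) (h : IsShortest G H) (v : V) :
    deg H v = 0 ∨ deg H v = 2 := by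
  have l := deg_le_three hG h.le v
  have l1 : deg H v ≠ 1 := fun e => by
    have := vertexCount_pos e
    have := h.count_one hG
    omega
  have l3 : deg H v ≠ 3 := fun e => by
    have := vertexCount_pos e
    have := h.count_three hG
    omega
  omega

theorem hEdge (hG : ∀ v, deg G v = 3) (h : IsShortest G H) {x y : V} (hxy : H.Adj x y) :
    HEdge H 2 2 x y := by
  have := deg_pos_of_adj hxy
  have := deg_pos_of_adj hxy.symm
  have := h.deg_eq hG x
  have := h.deg_eq hG y
  exact ⟨hxy, by omega, by omega⟩

/-- Exchanging an edge at `u` for a chord keeps the weight but creates a vertex of degree one,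
against `count_one`. -/
theorem not_nonEdge (hG : ∀ v, deg G v = 3) (h : IsShortest G H) (u v : V) :
    ¬ NonEdge G H 2 2 u v := by
  intro e
  obtain ⟨z, hz⟩ := exists_adj_of_deg_pos (show 0 < deg H u by rw [e.left]; simp)
  obtain ⟨H1, hH1, a1, -, -, k⟩ := e.add h.le
  obtain ⟨H2, hH2, a2, -, -, k'⟩ := (a1.hEdge_add (h.hEdge hG hz)).remove hH1
  simp at k k'
  have c1 := h.count_one hG
  have c3 := h.count_three hG
  have hp := vertexCount_pos e.left
  have := (h.of_weight_le hH2 (by omega) (by unfold weight; omega)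
    (by unfold weight; omega)).count_one hG
  omega

end IsShortest

theorem deg_bot (v : V) : deg (⊥ : SimpleGraph V) v = 0 := by
  rw [deg_eq_card]
  simp

theorem vertexCount_bot {k : ℕ} (hk : k ≠ 0) : vertexCount (⊥ : SimpleGraph V) k = 0 := by
  by_contra h
  obtain ⟨v, hv⟩ := exists_of_vertexCount_pos (Nat.pos_of_ne_zero h)
  exact hk (hv.symm.trans (deg_bot v))

theorem nonEdge_bot {x y : V} (h : G.Adj x y) : NonEdge G ⊥ 0 0 x y :=
  ⟨h, by simp, deg_bot x, deg_bot y⟩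

theorem IsShortest.weight_le_of_triangle (h : IsShortest G H) {a b c : V} (hab : G.Adj a b)
    (hbc : G.Adj b c) (hac : G.Adj a c) : weight H ≤ 6 := by
  obtain ⟨H1, hH1, a1, -, -, k1⟩ := (nonEdge_bot hab).add bot_le
  have e1 := a1.symm.nonEdge_add (nonEdge_bot hbc) hac.ne.symm
  have e2 := a1.nonEdge_add (nonEdge_bot hac) hbc.ne.symm
  obtain ⟨H2, hH2, a2, -, -, k2⟩ := e1.add hH1
  have e3 := a2.symm.nonEdge_add e2.symm hab.ne
  obtain ⟨H3, hH3, a3, -, -, k3⟩ := e3.add hH2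
  simp at k1 k2 k3
  have b1 := vertexCount_bot (V := V) (k := 1) (by simp)
  have b2 := vertexCount_bot (V := V) (k := 2) (by simp)
  have b3 := vertexCount_bot (V := V) (k := 3) (by simp)
  refine (h.min H3 hH3 (by omega) ?_).trans ?_ <;> unfold weight <;> omega

theorem IsShortest.weight_le_of_square (h : IsShortest G H) {a b c d : V} (hab : G.Adj a b)
    (hbc : G.Adj b c) (hcd : G.Adj c d) (hda : G.Adj d a) (hac : a ≠ c) (hbd : b ≠ d) :
    weight H ≤ 8 := by
  obtain ⟨H1, hH1, a1, -, -, k1⟩ := (nonEdge_bot hab).add bot_le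
  have e1 := a1.symm.nonEdge_add (nonEdge_bot hbc) hac.symm
  have e2 := a1.nonEdge_add (nonEdge_bot hda.symm) hbd.symm
  have e3 := (a1.nonEdge_iff hac.symm hbc.ne.symm hda.ne hbd.symm).2 (nonEdge_bot hcd)
  obtain ⟨H2, hH2, a2, -, -, k2⟩ := e1.add hH1
  have e4 := a2.symm.nonEdge_add e3 hbd.symm
  have e5 := (a2.nonEdge_iff hab.ne hac hbd.symm hcd.ne.symm).2 e2
  obtain ⟨H3, hH3, a3, -, -, k3⟩ := e4.add hH2
  have e6 := a3.symm.nonEdge_add e5.symm hac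
  obtain ⟨H4, hH4, a4, -, -, k4⟩ := e6.add hH3
  simp at k1 k2 k3 k4
  have b1 := vertexCount_bot (V := V) (k := 1) (by simp)
  have b2 := vertexCount_bot (V := V) (k := 2) (by simp)
  have b3 := vertexCount_bot (V := V) (k := 3) (by simp)
  refine (h.min H4 hH4 (by omega) ?_).trans ?_ <;> unfold weight <;> omega

/-- A vertex off a shortest cycle of length at least five has at most one neighbour on it. -/
theorem IsShortest.eq_of_nonEdge (hG : ∀ v, deg G v = 3) (h : IsShortest G H)
    (hs : 5 ≤ vertexCount H 2) {v x y : V} (hx : NonEdge G H 0 2 v x) (hy : NonEdge G H 0 2 v y) :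
    x = y := by
  by_contra hxy
  have hw := h.weight_eq hG
  have hxy' : ¬ H.Adj x y := fun e => by
    have := h.weight_le_of_triangle hx.adj (h.le e) hy.adj
    omega
  -- Otherwise `x`, `y` and the two `H`-neighbours of `x` span a 4-cycle, which is too short.
  obtain ⟨z, hxz, hzy⟩ : ∃ z, H.Adj x z ∧ ¬ H.Adj z y := by
    by_contra hno
    push Not at hno
    have hd := hx.right
    obtain ⟨z1, hz1⟩ := exists_adj_of_deg_pos (show 0 < deg H x by omega)
    obtain ⟨z2, hz2, hne⟩ := exists_adj_ne_of_deg (x := z1) (show 1 < deg H x by omega)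
    have := h.weight_le_of_square (h.le hz1) (h.le (hno _ hz1)) (h.le (hno _ hz2).symm)
      (h.le hz2.symm) hxy hne.symm
    omega
  have hzne : z ≠ y := fun e => hxy' (e ▸ hxz)
  have exz := h.hEdge hG hxz
  obtain ⟨z', hzz', hne⟩ := exists_adj_ne_of_deg (x := x) (show 1 < deg H z by rw [exz.right]; simp)
  have ezz := h.hEdge hG hzz'
  have hzy' : z' ≠ y := fun e => hzy (e ▸ hzz')
  have hzv : z ≠ v := ne_of_deg ezz.left hx.left (by simp)
  have hzv' : z' ≠ v := ne_of_deg ezz.right hx.left (by simp)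
  have hxv := hx.ne
  have hyv := hy.ne
  -- Replacing x-z-z' by x-v-y keeps the weight; `y` gets degree three and z' degree one, against
  -- `count_one`.
  obtain ⟨H1, hH1, a1, -, -, k1⟩ := hx.add h.le
  obtain ⟨H2, hH2, a2, -, -, k2⟩ := (a1.nonEdge_add hy (Ne.symm hxy)).add hH1
  have exz2 := (a2.hEdge_iff hxv.symm hxy hzv hzne).2 (a1.symm.hEdge_add exz)
  have ezz2 := (a2.hEdge_iff hzv hzne hzv' hzy').2
    ((a1.hEdge_iff hzv hxz.ne.symm hzv' hne).2 ezz)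
  obtain ⟨H3, hH3, a3, -, -, k3⟩ := exz2.remove hH2
  obtain ⟨H4, hH4, a4, -, -, k4⟩ := (a3.symm.hEdge_remove ezz2 hne).remove hH3
  simp at k1 k2 k3 k4
  have c1 := h.count_one hG
  have c3 := h.count_three hG
  have := (h.of_weight_le hH4 (by omega) (by unfold weight; omega)
    (by unfold weight; omega)).count_one hG
  omega

end Entry


/-! ### From a shortest cycle into the cone. -/

section Growth
open Finset
open scoped Classical
variable {V : Type*} [Fintype V] {G H : SimpleGraph V}

/-- The spanning subgraphs from which `realizes_of_cone` starts. -/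
def InCone (q m : ℕ) (H : SimpleGraph V) : Prop :=
  m ≤ vertexCount H 0 ∧ vertexCount H 1 ≤ q ∧ vertexCount H 2 ≤ m ∧ q ≤ vertexCount H 3

theorem exists_nonEdge_of_deg_two (hG : ∀ v, deg G v = 3) (hH : H ≤ G) {x : V}
    (hx : deg H x = 2) : ∃ j y, NonEdge G H 2 j x y ∧ j ≤ 2 := by
  have := deg_sdiff_add hH x
  have := hG x
  obtain ⟨y, hy⟩ := exists_adj_of_deg_pos (show 0 < deg (G \ H) x by omega)
  exact ⟨deg H y, y, ⟨hy.1, hy.2, hx, rfl⟩,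
    Nat.le_of_lt_succ (deg_lt_of_not_adj hG hH hy.1.symm fun h => hy.2 h.symm)⟩

/-- Edges are added while n1 ≤ n3 and n2 ≤ m persist. Once n3 = q, the bound n0 ≥ m follows from n =
2q + 2m. -/
theorem exists_inCone_of_growth (hG : ∀ v, deg G v = 3) (hc : G.Preconnected) {q m : ℕ}
    (hm : m = q ∨ m = q + 1) (hcard : Fintype.card V = 2 * q + 2 * m) (hq : 0 < q) (N : ℕ) :
    ∀ H ≤ G, vertexCount H 1 ≤ vertexCount H 3 → vertexCount H 3 ≤ q → vertexCount H 2 ≤ m →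
      0 < weight H → 3 * Fintype.card V ≤ N + weight H → ∃ H' ≤ G, InCone q m H' := by
  induction N with
  | zero =>
    intro H hH h13 h3 h2 hw hN
    have := sum_vertexCount hG hH
    unfold weight at hN
    omega
  | succ N ih =>
    intro H hH h13 h3 h2 hw hN
    have hs := sum_vertexCount hG hH
    by_cases h3' : vertexCount H 3 = q
    · exact ⟨H, hH, by omega, by omega, by omega, by omega⟩
    unfold weight at hw hN
    by_cases h0 : vertexCount H 2 = 0
    · obtain ⟨u, v, h⟩ : ∃ u v, NonEdge G H 0 1 u v := by
        by_contra hn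
        push Not at hn
        obtain ⟨a, ha⟩ := exists_of_vertexCount_pos (show 0 < vertexCount H 0 by omega)
        have hall := mem_of_closed (p := fun a => deg H a = 0) hc ha fun x y hx hxy => by
          rcases nonEdge_of_deg_zero hG hH hx hxy with h | h | h
          · exact h.right
          · exact absurd h (hn _ _)
          · exact absurd (vertexCount_pos h.right) (by omega)
        obtain ⟨z, hz⟩ := exists_of_vertexCount_pos (show 0 < vertexCount H 3 by omega)
        have := hall z
        omega
      obtain ⟨H1, hH1, -, -, -, k⟩ := h.add hH
      simp at k
      exact ih H1 hH1 (by omega) (by omega) (by omega) (by unfold weight; omega)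
        (by unfold weight; omega)
    · obtain ⟨x, hx⟩ := exists_of_vertexCount_pos (Nat.pos_of_ne_zero h0)
      obtain ⟨j, y, h, hj⟩ := exists_nonEdge_of_deg_two hG hH hx
      obtain ⟨H1, hH1, -, -, -, k⟩ := h.add hH
      have hs1 := sum_vertexCount hG hH1
      by_cases hlast : vertexCount H1 3 ≤ q
      · refine ih H1 hH1 ?_ hlast ?_ ?_ ?_ <;> (try unfold weight) <;> interval_cases j <;>
          simp at k <;> omega
      -- Here n3 jumped from q − 1 to q + 1, so a 2-2 edge was added.
      · refine ⟨H1, hH1, ?_, ?_, ?_, ?_⟩ <;> interval_cases j <;> simp at k <;> omega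

/-- Attaching pendant edges to a long shortest cycle. -/
theorem IsShortest.exists_pendant (hG : ∀ v, deg G v = 3) (h : IsShortest G H)
    (hs : 5 ≤ vertexCount H 2) (j : ℕ) (hj : j ≤ vertexCount H 2) :
    ∃ H' ≤ G, vertexCount H' 0 + j = vertexCount H 0 ∧ vertexCount H' 1 = j ∧
      vertexCount H' 2 + j = vertexCount H 2 ∧ vertexCount H' 3 = j ∧
      (∀ i x y, i ≤ 2 → NonEdge G H' 2 i x y → i = 0) ∧
      ∀ v x y, NonEdge G H' 0 2 v x → NonEdge G H' 0 2 v y → x = y := by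
  induction j with
  | zero =>
    refine ⟨H, h.le, rfl, h.count_one hG, rfl, h.count_three hG, ?_,
      fun v x y => h.eq_of_nonEdge hG hs⟩
    intro i x y hi hxy
    have := hxy.right
    rcases h.deg_eq hG y with h0 | h2
    · omega
    · exact absurd ⟨hxy.adj, hxy.not_adj, hxy.left, h2⟩ (h.not_nonEdge hG x y)
  | succ j ih =>
    obtain ⟨H1, hH1, c0, c1, c2, c3, p, r⟩ := ih (by omega)
    obtain ⟨x, hx⟩ := exists_of_vertexCount_pos (show 0 < vertexCount H1 2 by omega)
    obtain ⟨i, v, e, hi⟩ := exists_nonEdge_of_deg_two hG hH1 hx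
    obtain rfl := p i x v hi e
    obtain ⟨H2, hH2, a, dx, dv, k⟩ := e.add hH1
    simp at k
    refine ⟨H2, hH2, by omega, by omega, by omega, by omega, ?_, ?_⟩
    · intro i b y hi hb
      have n1 : b ≠ x := ne_of_deg hb.left dx (by simp)
      have n2 : b ≠ v := ne_of_deg hb.left dv (by simp)
      have n3 : y ≠ x := ne_of_deg hb.right dx (by omega)
      -- If `y` were the vertex just attached, it would have had two neighbours of degree two.
      have n4 : y ≠ v := by
        rintro rfl
        have hn : ¬ H1.Adj b y := by
          have := hb.not_adj
          rwa [a.adj_of_ne n1 n2] at this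
        have hd : deg H1 b = 2 := by rw [← a.deg_of_ne n1 n2, hb.left]
        exact n1 (r y b x ⟨hb.adj.symm, fun h => hn h.symm, e.right, hd⟩ e.symm)
      exact p i b y hi ((a.nonEdge_iff n1 n2 n3 n4).1 hb)
    · have conv : ∀ w b, NonEdge G H2 0 2 w b → NonEdge G H1 0 2 w b := fun w b hb =>
        (a.nonEdge_iff (ne_of_deg hb.left dx (by simp)) (ne_of_deg hb.left dv (by simp))
          (ne_of_deg hb.right dx (by simp)) (ne_of_deg hb.right dv (by simp))).1 hb
      exact fun w b b' hb hb' => r w b b' (conv w b hb) (conv w b' hb')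

theorem IsShortest.exists_nonEdge (hG : ∀ v, deg G v = 3) (h : IsShortest G H) {x : V}
    (hx : deg H x = 2) : ∃ v, NonEdge G H 0 2 v x := by
  obtain ⟨j, v, e, hj⟩ := exists_nonEdge_of_deg_two hG h.le hx
  have := e.right
  rcases h.deg_eq hG v with h0 | h2
  · exact ⟨v, e.adj.symm, fun h => e.not_adj h.symm, h0, hx⟩
  · exact absurd ⟨e.adj, e.not_adj, hx, h2⟩ (h.not_nonEdge hG x v)

/-- Every cycle vertex has its third neighbour off the cycle, and these are distinct by
`eq_of_nonEdge`. -/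
theorem IsShortest.two_mul_le (hG : ∀ v, deg G v = 3) (h : IsShortest G H)
    (hs : 5 ≤ vertexCount H 2) : 2 * vertexCount H 2 ≤ Fintype.card V := by
  have hsum := sum_vertexCount hG h.le
  suffices vertexCount H 2 ≤ vertexCount H 0 by omega
  have hch : ∀ x : V, ∃ v, deg H x = 2 → NonEdge G H 0 2 v x := fun x => by
    by_cases hx : deg H x = 2
    · obtain ⟨v, hv⟩ := h.exists_nonEdge hG hx
      exact ⟨v, fun _ => hv⟩
    · exact ⟨x, fun h => absurd h hx⟩
  choose g hg using hch
  rw [vertexCount_eq, vertexCount_eq]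
  refine card_le_card_of_injOn g (fun x hx => ?_) fun x hx y hy hxy => ?_
  · simp only [coe_filter, mem_univ, true_and, Set.mem_ofPred_eq] at hx ⊢
    exact (hg x hx).left
  · simp only [coe_filter, mem_univ, true_and, Set.mem_ofPred_eq] at hx hy
    exact h.eq_of_nonEdge hG hs (hg x hx) (hxy ▸ hg y hy)

/-- The neighbourhood of a vertex is independent, so each of its three members is joined to the
whole complement. -/
theorem nonempty_iso_graphK33 (hG : ∀ v, deg G v = 3) (hcard : Fintype.card V = 6)
    (htri : ∀ a b c, G.Adj a b → G.Adj b c → ¬ G.Adj a c) : Nonempty (G ≃g graphK33) := by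
  obtain ⟨v⟩ : Nonempty V := Fintype.card_pos_iff.1 (by omega)
  set A : Finset V := univ.filter fun w => G.Adj v w with hA
  have hAc : A.card = 3 := by rw [← hG v, deg_eq_card]
  have hBc : Aᶜ.card = 3 := by rw [card_compl, hcard, hAc]
  have hAB : ∀ a ∈ A, ∀ b, G.Adj a b ↔ b ∉ A := by
    intro a ha
    have hva : G.Adj v a := by simpa [hA] using ha
    have hsub : (univ.filter fun w => G.Adj a w) ⊆ Aᶜ := by
      intro w hw
      simp only [mem_filter, mem_univ, true_and, mem_compl, hA] at hw ⊢
      exact htri _ _ _ hva hw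
    have heq := eq_of_subset_of_card_le hsub (by rw [hBc, ← deg_eq_card, hG])
    intro b
    rw [← mem_compl, ← heq]
    simp
  have hBA : ∀ b ∉ A, ∀ a, G.Adj b a ↔ a ∈ A := by
    intro b hb
    have hsub : A ⊆ (univ.filter fun w => G.Adj b w) := by
      intro w hw
      simpa using ((hAB w hw b).2 hb).symm
    have heq := eq_of_subset_of_card_le hsub (by rw [hAc, ← deg_eq_card, hG])
    intro a
    rw [heq]
    simp
  have e1 : {x // x ∈ A} ≃ Fin 3 := Fintype.equivFinOfCardEq (by simpa using hAc)
  have e2 : {x // x ∉ A} ≃ Fin 3 := Fintype.equivFinOfCardEq (by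
    rw [Fintype.card_subtype_compl]; simp [hcard, hAc])
  let e := (Equiv.sumCompl fun x => x ∈ A).symm.trans (Equiv.sumCongr e1 e2)
  refine ⟨⟨e, ?_⟩⟩
  have he1 : ∀ x (hx : x ∈ A), e x = Sum.inl (e1 ⟨x, hx⟩) := fun x hx => by
    simp [e, Equiv.sumCompl_symm_apply_of_pos (p := fun x => x ∈ A) hx]
  have he2 : ∀ x (hx : x ∉ A), e x = Sum.inr (e2 ⟨x, hx⟩) := fun x hx => by
    simp [e, Equiv.sumCompl_symm_apply_of_neg (p := fun x => x ∈ A) hx]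
  intro a b
  by_cases ha : a ∈ A <;> by_cases hb : b ∈ A
  · rw [he1 a ha, he1 b hb, hAB a ha]
    simp [hb]
  · rw [he1 a ha, he2 b hb, hAB a ha]
    simp [hb]
  · rw [he2 a ha, he1 b hb, hBA a ha]
    simp [hb]
  · rw [he2 a ha, he2 b hb, hBA a ha]
    simp [hb]

/-- Cycles of length s ≤ m grow directly, those with s = m + 1 after one pendant edge, and those
with s ≥ 5 get q pendant edges. There remains s = 4, m = 2, with n = 8 or n = 6. -/
theorem exists_inCone (hG : ∀ v, deg G v = 3) (hc : G.Preconnected) {q m : ℕ}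
    (hm : m = q ∨ m = q + 1) (hcard : Fintype.card V = 2 * q + 2 * m)
    (h6 : 6 ≤ Fintype.card V) (hK33 : ¬ Nonempty (G ≃g graphK33)) : ∃ H ≤ G, InCone q m H := by
  obtain ⟨H, h⟩ := exists_isShortest hG (by omega)
  have hsum := sum_vertexCount hG h.le
  have c1 := h.count_one hG
  have c3 := h.count_three hG
  have hw := h.weight_eq hG
  have hp := h.pos
  obtain ⟨x, hx⟩ := exists_of_vertexCount_pos (show 0 < vertexCount H 2 by omega)
  obtain ⟨v, e⟩ := h.exists_nonEdge hG hx
  have hq : 0 < q := by omega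
  by_cases hs1 : vertexCount H 2 ≤ m
  · exact exists_inCone_of_growth hG hc hm hcard hq _ H h.le (by omega) (by omega) hs1 hp
      (Nat.le_add_right _ _)
  obtain ⟨H1, hH1, a, -, -, k⟩ := e.add h.le
  simp at k
  by_cases hs2 : vertexCount H 2 = m + 1
  · exact exists_inCone_of_growth hG hc hm hcard hq _ H1 hH1 (by omega) (by omega) (by omega)
      (by unfold weight; omega) (Nat.le_add_right _ _)
  by_cases hs3 : 5 ≤ vertexCount H 2
  -- From 2s ≤ n one gets s − q ≤ m for the new n2, and n − s − q ≥ m for the new n0.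
  · have := h.two_mul_le hG hs3
    obtain ⟨H2, hH2, d0, d1, d2, d3, -⟩ := h.exists_pendant hG hs3 q (by omega)
    exact ⟨H2, hH2, by omega, by omega, by omega, by omega⟩
  have hm2 : m = 2 := by omega
  have hs4 : vertexCount H 2 = 4 := by omega
  rcases hm with hm | hm
  -- For n = 8, `v` misses one of the four cycle vertices, which allows a second, disjoint pendant
  -- edge.
  · obtain ⟨x', hx', hvx⟩ : ∃ x', deg H x' = 2 ∧ ¬ G.Adj v x' := by
      by_contra hno
      push Not at hno
      have : vertexCount H 2 ≤ deg G v := by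
        rw [vertexCount_eq, deg_eq_card]
        refine card_le_card fun y hy => ?_
        simp only [mem_filter, mem_univ, true_and] at hy ⊢
        exact hno y hy
      have := hG v
      omega
    obtain ⟨v', e'⟩ := h.exists_nonEdge hG hx'
    have n1 : v' ≠ v := by
      rintro rfl
      exact hvx e'.adj
    have n2 : x' ≠ x := by
      rintro rfl
      exact hvx e.adj
    obtain ⟨H2, hH2, -, -, -, k'⟩ := ((a.nonEdge_iff n1 (ne_of_deg e'.left e.right (by simp))
      (ne_of_deg e'.right e.left (by simp)) n2).2 e').add hH1
    simp at k'
    exact ⟨H2, hH2, by omega, by omega, by omega, by omega⟩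
  · refine absurd (nonempty_iso_graphK33 hG (by omega) fun a b c hab hbc hac => ?_) hK33
    have := h.weight_le_of_triangle hab hbc hac
    omega

theorem nonempty_iso_graphK4 (hG : ∀ v, deg G v = 3) (hcard : Fintype.card V = 4) :
    Nonempty (G ≃g graphK4) := by
  have hadj : ∀ a b, G.Adj a b ↔ a ≠ b := by
    intro a
    have hsub : (univ.filter fun w => G.Adj a w) ⊆ univ.erase a := by
      intro w hw
      simp only [mem_filter, mem_univ, true_and] at hw
      simp [hw.ne.symm]
    have heq := eq_of_subset_of_card_le hsub (by
      rw [card_erase_of_mem (mem_univ a), card_univ, hcard, ← deg_eq_card, hG])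
    intro b
    have := congrArg (fun s => b ∈ s) heq
    simp only [mem_filter, mem_univ, true_and, mem_erase, and_true, eq_iff_iff] at this
    rw [this]
    exact ne_comm
  let e : V ≃ Fin 4 := Fintype.equivFinOfCardEq hcard
  exact ⟨⟨e, fun {a b} => by rw [hadj]; simp⟩⟩

/-- `G` has a balanced spanning subgraph, and one which is balanced up to a small perturbation. -/
def IsGood (G : SimpleGraph V) : Prop :=
  ∃ q m : ℕ, (m = q ∨ m = q + 1) ∧ Realizes G m q m q ∧
    ∃ a b c d, Realizes G a b c d ∧ NearBalanced q m a b c d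

theorem isGood_of_preconnected (hG : ∀ v, deg G v = 3) (hc : G.Preconnected)
    (hV : 0 < Fintype.card V) (hK4 : ¬ Nonempty (G ≃g graphK4))
    (hK33 : ¬ Nonempty (G ≃g graphK33)) : IsGood G := by
  have hsum := sum_vertexCount hG (le_refl G)
  obtain ⟨t, ht⟩ := even_odd_count hG (le_refl G)
  have hk : ∀ k, k ≠ 3 → vertexCount G k = 0 := fun k hk => by
    by_contra h
    obtain ⟨v, hv⟩ := exists_of_vertexCount_pos (Nat.pos_of_ne_zero h)
    exact hk (hv.symm.trans (hG v))
  have k0 := hk 0 (by simp)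
  have k1 := hk 1 (by simp)
  have k2 := hk 2 (by simp)
  have h4 : 4 ≤ Fintype.card V := by
    obtain ⟨v⟩ := Fintype.card_pos_iff.1 hV
    have := G.degree_lt_card_verts v
    rw [← deg_eq_degree, hG] at this
    omega
  have hne : Fintype.card V ≠ 4 := fun h => hK4 (nonempty_iso_graphK4 hG h)
  obtain ⟨q, m, hm, hcard⟩ : ∃ q m : ℕ, (m = q ∨ m = q + 1) ∧ Fintype.card V = 2 * q + 2 * m :=
    ⟨t / 2, t - t / 2, by omega, by omega⟩
  obtain ⟨H, hH, h0, h1, h2, h3⟩ := exists_inCone hG hc hm hcard (by omega) hK33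
  have hr := realizes_of_cone hG hc hm hcard (by omega) _ H hH h0 h1 h2 h3
    (show _ ≤ (vertexCount H 0 + vertexCount H 3) + m + q by omega)
  exact ⟨q, m, hm, hr, exists_nearBalanced hG hc hm (by omega) hr⟩

end Growth


/-! ### Degree counts under isomorphism and disjoint union. -/

section DisjointUnion
open Finset
open scoped Classical
variable {V W : Type*} [Fintype V] [Fintype W] {G : SimpleGraph V} {G' : SimpleGraph W}

theorem SimpleGraph.Iso.deg_eq (e : G ≃g G') (v : V) : deg G' (e v) = deg G v := by
  rw [deg_eq_card, deg_eq_card]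
  refine (card_equiv e.toEquiv fun w => ?_).symm
  simp only [mem_filter, mem_univ, true_and]
  exact e.map_adj_iff.symm

theorem SimpleGraph.Iso.vertexCount_eq (e : G ≃g G') (k : ℕ) :
    vertexCount G' k = vertexCount G k := by
  rw [_root_.vertexCount_eq, _root_.vertexCount_eq]
  refine (card_equiv e.toEquiv fun w => ?_).symm
  simp only [mem_filter, mem_univ, true_and]
  rw [← e.deg_eq]
  rfl

theorem Realizes.of_iso (e : G ≃g G') {a b c d : ℕ} (h : Realizes G' a b c d) :
    Realizes G a b c d := by
  obtain ⟨H, hH, h0, h1, h2, h3⟩ := h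
  have f : H.comap e ≃g H := SimpleGraph.Iso.comap e.toEquiv H
  refine ⟨H.comap e, fun x y hxy => e.map_adj_iff.1 (hH hxy), ?_, ?_, ?_, ?_⟩ <;>
    rw [← f.vertexCount_eq] <;> assumption

theorem IsGood.of_iso (e : G ≃g G') (h : IsGood G') : IsGood G := by
  obtain ⟨q, m, hm, h1, a, b, c, d, h2, h3⟩ := h
  exact ⟨q, m, hm, h1.of_iso e, a, b, c, d, h2.of_iso e, h3⟩

theorem deg_sum_inl (v : V) : deg (G ⊕g G') (.inl v) = deg G v := by
  rw [deg_eq_card, deg_eq_card, card_filter, card_filter, Fintype.sum_sum_type]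
  simp

theorem deg_sum_inr (v : W) : deg (G ⊕g G') (.inr v) = deg G' v := by
  rw [deg_eq_card, deg_eq_card, card_filter, card_filter, Fintype.sum_sum_type]
  simp

theorem deg_sum (hG : ∀ v, deg G v = 3) (hG' : ∀ v, deg G' v = 3) (v : V ⊕ W) :
    deg (G ⊕g G') v = 3 := by
  rcases v with v | v
  · rw [deg_sum_inl, hG]
  · rw [deg_sum_inr, hG']

theorem vertexCount_sum (k : ℕ) :
    vertexCount (G ⊕g G') k = vertexCount G k + vertexCount G' k := by
  rw [vertexCount_eq, vertexCount_eq, vertexCount_eq, card_filter, card_filter, card_filter,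
    Fintype.sum_sum_type]
  simp only [deg_sum_inl, deg_sum_inr]

theorem Realizes.sum {a b c d a' b' c' d' : ℕ} (h : Realizes G a b c d)
    (h' : Realizes G' a' b' c' d') :
    Realizes (G ⊕g G') (a + a') (b + b') (c + c') (d + d') := by
  obtain ⟨H, hH, h0, h1, h2, h3⟩ := h
  obtain ⟨H', hH', h0', h1', h2', h3'⟩ := h'
  refine ⟨H ⊕g H', ?_, ?_, ?_, ?_, ?_⟩
  · rintro (x | x) (y | y) hxy
    · exact hH hxy
    · exact hxy
    · exact hxy
    · exact hH' hxy
  all_goals rw [vertexCount_sum]; omega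

theorem Realizes.congr {a b c d a' b' c' d' : ℕ} (h : Realizes G a b c d) (ha : a = a')
    (hb : b = b') (hc : c = c') (hd : d = d') : Realizes G a' b' c' d' := by
  subst ha hb hc hd
  exact h

end DisjointUnion

/-! ### Explicit subgraphs of K4 and K33. -/

section SmallGraphs
open Finset

/-- Degree of a vertex in the graph with the given list of edges. -/
def listDegree {V : Type*} [Fintype V] [DecidableEq V] (l : List (V × V)) (v : V) : ℕ :=
  (univ.filter fun w => v ≠ w ∧ ((v, w) ∈ l ∨ (w, v) ∈ l)).card

theorem realizes_of_list {V : Type*} [Fintype V] [DecidableEq V] {G : SimpleGraph V}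
    (l : List (V × V)) {a b c d : ℕ} (hl : ∀ p ∈ l, G.Adj p.1 p.2)
    (h : (univ.filter fun v => listDegree l v = 0).card = a ∧
      (univ.filter fun v => listDegree l v = 1).card = b ∧
      (univ.filter fun v => listDegree l v = 2).card = c ∧
      (univ.filter fun v => listDegree l v = 3).card = d) : Realizes G a b c d := by
  have hd : ∀ v, deg (SimpleGraph.fromRel fun x y => (x, y) ∈ l) v = listDegree l v := by
    intro v
    rw [deg_eq_card, listDegree]
    congr 1
    ext w
    simp
  refine ⟨SimpleGraph.fromRel fun x y => (x, y) ∈ l, ?_, ?_⟩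
  · rintro x y ⟨-, hxy | hxy⟩
    · exact hl _ hxy
    · exact (hl _ hxy).symm
  · simp only [vertexCount_eq, hd]
    exact h

theorem deg_graphK4 (v : Fin 4) : deg graphK4 v = 3 := by
  rw [deg_eq_degree]
  revert v
  decide

theorem deg_graphK33 (v : Fin 3 ⊕ Fin 3) : deg graphK33 v = 3 := by
  rw [deg_eq_card]
  rcases v with v | v <;> rw [card_filter, Fintype.sum_sum_type] <;> simp

theorem graphK4_realizes_4000 : Realizes graphK4 4 0 0 0 :=
  realizes_of_list [] (by decide) (by decide)

theorem graphK4_realizes_2200 : Realizes graphK4 2 2 0 0 :=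
  realizes_of_list [(0, 1)] (by decide) (by decide)

theorem graphK4_realizes_1210 : Realizes graphK4 1 2 1 0 :=
  realizes_of_list [(0, 1), (1, 2)] (by decide) (by decide)

theorem graphK4_realizes_0220 : Realizes graphK4 0 2 2 0 :=
  realizes_of_list [(0, 1), (1, 2), (2, 3)] (by decide) (by decide)

theorem graphK4_realizes_0301 : Realizes graphK4 0 3 0 1 :=
  realizes_of_list [(0, 1), (0, 2), (0, 3)] (by decide) (by decide)

theorem graphK4_realizes_0022 : Realizes graphK4 0 0 2 2 :=
  graphK4_realizes_2200.reverse deg_graphK4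

theorem graphK4_realizes_0121 : Realizes graphK4 0 1 2 1 :=
  graphK4_realizes_1210.reverse deg_graphK4

theorem graphK33_realizes_of_list (l : List (Fin 3 × Fin 3)) {a b c d : ℕ}
    (h : let l' : List ((Fin 3 ⊕ Fin 3) × (Fin 3 ⊕ Fin 3)) :=
        l.map fun p => (Sum.inl p.1, Sum.inr p.2)
      (univ.filter fun v => listDegree l' v = 0).card = a ∧
      (univ.filter fun v => listDegree l' v = 1).card = b ∧
      (univ.filter fun v => listDegree l' v = 2).card = c ∧
      (univ.filter fun v => listDegree l' v = 3).card = d) : Realizes graphK33 a b c d := by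
  refine realizes_of_list _ ?_ h
  intro p hp
  obtain ⟨x, -, rfl⟩ := List.mem_map.1 hp
  simp

theorem graphK33_realizes_4200 : Realizes graphK33 4 2 0 0 :=
  graphK33_realizes_of_list [(0, 0)] (by decide)

theorem graphK33_realizes_3210 : Realizes graphK33 3 2 1 0 :=
  graphK33_realizes_of_list [(0, 0), (0, 1)] (by decide)

theorem graphK33_realizes_2301 : Realizes graphK33 2 3 0 1 :=
  graphK33_realizes_of_list [(0, 0), (0, 1), (0, 2)] (by decide)

theorem graphK33_realizes_1311 : Realizes graphK33 1 3 1 1 :=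
  graphK33_realizes_of_list [(0, 0), (0, 1), (0, 2), (1, 0)] (by decide)

theorem graphK33_realizes_0321 : Realizes graphK33 0 3 2 1 :=
  graphK33_realizes_of_list [(0, 0), (0, 1), (0, 2), (1, 0), (2, 1)] (by decide)

theorem graphK33_realizes_0222 : Realizes graphK33 0 2 2 2 :=
  graphK33_realizes_of_list [(0, 0), (0, 1), (0, 2), (1, 0), (2, 0), (1, 1)] (by decide)

theorem graphK33_realizes_1032 : Realizes graphK33 1 0 3 2 :=
  graphK33_realizes_2301.reverse deg_graphK33

theorem graphK33_realizes_0123 : Realizes graphK33 0 1 2 3 :=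
  graphK33_realizes_3210.reverse deg_graphK33

end SmallGraphs

/-! ### Closure of good graphs under adding components. -/

section Closure
variable {V W : Type*} [Fintype V] [Fintype W] {G : SimpleGraph V} {G' : SimpleGraph W}

theorem NearBalanced.add {q m a b c d q' m' : ℕ} (h : NearBalanced q m a b c d) :
    NearBalanced (q + q') (m + m') (a + m') (b + q') (c + m') (d + q') := by
  unfold NearBalanced at h ⊢
  rcases h with h | h | h | h | h
  · left; omega
  · right; left; omega
  · right; right; left; omega
  · right; right; right; left; omega
  · right; right; right; right; omega

theorem IsGood.sum (hG' : ∀ v, deg G' v = 3) (h : IsGood G)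
    (h' : IsGood G') : IsGood (G ⊕g G') := by
  obtain ⟨q, m, hm, h1, a, b, c, d, h2, h3⟩ := h
  obtain ⟨q', m', hm', h1', -⟩ := h'
  by_cases hs : m = q + 1 ∧ m' = q' + 1
  -- With m = q + 1 in both parts, reversing the second pairs large entries with small ones.
  · refine ⟨q + m', m + q', by omega, h1.sum (h1'.reverse hG'), _, _, _, _,
      h2.sum (h1'.reverse hG'), ?_⟩
    exact h3.add
  · exact ⟨q + q', m + m', by omega, h1.sum h1', _, _, _, _, h2.sum h1', h3.add⟩

/-- Each of the five perturbations is repaired by its own subgraph of K4. Conversely, a balanced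
subgraph together with a single edge of K4 is perturbed in the fourth way. -/
theorem IsGood.sum_graphK4 (h : IsGood G) : IsGood (G ⊕g graphK4) := by
  obtain ⟨q, m, hm, h1, a, b, c, d, h2, h3⟩ := h
  refine ⟨q + 1, m + 1, by omega, ?_, _, _, _, _, h1.sum graphK4_realizes_2200, ?_⟩
  · rcases h3 with h3 | h3 | h3 | h3 | h3
    · exact (h2.sum graphK4_realizes_0121).congr (by omega) (by omega) (by omega) (by omega)
    · exact (h2.sum graphK4_realizes_1210).congr (by omega) (by omega) (by omega) (by omega)
    · exact (h2.sum graphK4_realizes_0220).congr (by omega) (by omega) (by omega) (by omega)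
    · exact (h2.sum graphK4_realizes_0022).congr (by omega) (by omega) (by omega) (by omega)
    · exact (h2.sum graphK4_realizes_2200).congr (by omega) (by omega) (by omega) (by omega)
  · unfold NearBalanced
    omega

theorem IsGood.sum_graphK33 (hG : ∀ v, deg G v = 3) (h : IsGood G) :
    IsGood (G ⊕g graphK33) := by
  obtain ⟨q, m, hm, h1, a, b, c, d, h2, h3⟩ := h
  -- This is the target when m = q + 1 and its reverse when m = q.
  have key : Realizes (G ⊕g graphK33) (m + 1) (q + 2) (m + 1) (q + 2) := by
    rcases h3 with h3 | h3 | h3 | h3 | h3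
    · exact (h2.sum graphK33_realizes_0222).congr (by omega) (by omega) (by omega) (by omega)
    · exact (h2.sum graphK33_realizes_1311).congr (by omega) (by omega) (by omega) (by omega)
    · exact (h2.sum graphK33_realizes_0321).congr (by omega) (by omega) (by omega) (by omega)
    · exact (h2.sum graphK33_realizes_0123).congr (by omega) (by omega) (by omega) (by omega)
    · exact (h2.sum graphK33_realizes_2301).congr (by omega) (by omega) (by omega) (by omega)
  rcases hm with rfl | rfl
  · refine ⟨m + 1, m + 2, by omega, key.reverse (deg_sum hG deg_graphK33), _, _, _, _,
      h1.sum graphK33_realizes_3210, ?_⟩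
    unfold NearBalanced
    omega
  · refine ⟨q + 2, q + 2, by omega, key, _, _, _, _,
      (h1.reverse hG).sum graphK33_realizes_3210, ?_⟩
    unfold NearBalanced
    omega

theorem isGood_graphK4_sum_graphK33 : IsGood (graphK4 ⊕g graphK33) :=
  ⟨2, 3, by omega, graphK4_realizes_2200.sum graphK33_realizes_1032, _, _, _, _,
    graphK4_realizes_4000.sum graphK33_realizes_0321, by unfold NearBalanced; omega⟩

theorem isGood_graphK33_sum_graphK33 : IsGood (graphK33 ⊕g graphK33) :=
  ⟨3, 3, by omega, graphK33_realizes_2301.sum graphK33_realizes_1032, _, _, _, _,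
    graphK33_realizes_4200.sum graphK33_realizes_0222, by unfold NearBalanced; omega⟩

/-- Four copies of K4 are good, which ends the list of exceptions. -/
theorem isGood_graphK4_sum_graphThreeK4 : IsGood (graphK4 ⊕g graphThreeK4) :=
  ⟨4, 4, by omega, graphK4_realizes_2200.sum
      (graphK4_realizes_2200.sum (graphK4_realizes_0022.sum graphK4_realizes_0022)), _, _, _, _,
    graphK4_realizes_0022.sum
      (graphK4_realizes_0301.sum (graphK4_realizes_1210.sum graphK4_realizes_4000)),
    by unfold NearBalanced; omega⟩

/-- The five types of cubic graphs: good ones, and four exceptional ones. -/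
def Classified (G : SimpleGraph V) : Prop :=
  IsGood G ∨ Nonempty (G ≃g graphK4) ∨ Nonempty (G ≃g graphK33) ∨
    Nonempty (G ≃g (graphK4 ⊕g graphK4)) ∨ Nonempty (G ≃g graphThreeK4)

theorem Classified.of_iso (e : G ≃g G') (h : Classified G') : Classified G := by
  rcases h with h | ⟨⟨f⟩⟩ | ⟨⟨f⟩⟩ | ⟨⟨f⟩⟩ | ⟨⟨f⟩⟩
  · exact .inl (h.of_iso e)
  · exact .inr (.inl ⟨e.trans f⟩)
  · exact .inr (.inr (.inl ⟨e.trans f⟩))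
  · exact .inr (.inr (.inr (.inl ⟨e.trans f⟩)))
  · exact .inr (.inr (.inr (.inr ⟨e.trans f⟩)))

theorem IsGood.graphK4_sum (h : IsGood G) : IsGood (graphK4 ⊕g G) :=
  h.sum_graphK4.of_iso SimpleGraph.Iso.sumComm

theorem IsGood.graphK33_sum (hG : ∀ v, deg G v = 3) (h : IsGood G) : IsGood (graphK33 ⊕g G) :=
  (h.sum_graphK33 hG).of_iso SimpleGraph.Iso.sumComm

theorem Classified.graphK4_sum (h : Classified G) : Classified (graphK4 ⊕g G) := by
  rcases h with h | ⟨⟨f⟩⟩ | ⟨⟨f⟩⟩ | ⟨⟨f⟩⟩ | ⟨⟨f⟩⟩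
  · exact .inl h.graphK4_sum
  · exact .inr (.inr (.inr (.inl ⟨.sumCongr .refl f⟩)))
  · exact .inl (isGood_graphK4_sum_graphK33.of_iso (.sumCongr .refl f))
  · exact .inr (.inr (.inr (.inr ⟨.sumCongr .refl f⟩)))
  · exact .inl (isGood_graphK4_sum_graphThreeK4.of_iso (.sumCongr .refl f))

theorem IsGood.classified_sum (hG : ∀ v, deg G v = 3) (hG' : ∀ v, deg G' v = 3) (h : IsGood G)
    (h' : Classified G') : IsGood (G ⊕g G') := by
  rcases h' with h' | ⟨⟨f⟩⟩ | ⟨⟨f⟩⟩ | ⟨⟨f⟩⟩ | ⟨⟨f⟩⟩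
  · exact h.sum hG' h'
  · exact h.sum_graphK4.of_iso (.sumCongr .refl f)
  · exact (h.sum_graphK33 hG).of_iso (.sumCongr .refl f)
  · exact (h.sum_graphK4.sum_graphK4.of_iso SimpleGraph.Iso.sumAssoc.symm).of_iso
      (.sumCongr .refl f)
  · exact ((h.sum_graphK4.sum_graphK4.sum_graphK4.of_iso SimpleGraph.Iso.sumAssoc.symm).of_iso
      SimpleGraph.Iso.sumAssoc.symm).of_iso
      (.sumCongr .refl f)

theorem Classified.graphK33_sum (hG : ∀ v, deg G v = 3) (h : Classified G) :
    IsGood (graphK33 ⊕g G) := by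
  have h43 : IsGood (graphK33 ⊕g graphK4) :=
    isGood_graphK4_sum_graphK33.of_iso SimpleGraph.Iso.sumComm
  rcases h with h | ⟨⟨f⟩⟩ | ⟨⟨f⟩⟩ | ⟨⟨f⟩⟩ | ⟨⟨f⟩⟩
  · exact h.graphK33_sum hG
  · exact h43.of_iso (.sumCongr .refl f)
  · exact isGood_graphK33_sum_graphK33.of_iso (.sumCongr .refl f)
  · exact (h43.sum_graphK4.of_iso SimpleGraph.Iso.sumAssoc.symm).of_iso (.sumCongr .refl f)
  · exact ((h43.sum_graphK4.sum_graphK4.of_iso SimpleGraph.Iso.sumAssoc.symm).of_iso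
      SimpleGraph.Iso.sumAssoc.symm).of_iso
      (.sumCongr .refl f)

end Closure

/-! ### Induction over components and the final count. -/

section Classification
open Finset
open scoped Classical

/-- A graph is the disjoint union of the subgraphs induced on a union of components and on its
complement. -/
noncomputable def isoInduceSum {V : Type*} (G : SimpleGraph V) (S : Set V)
    (hS : ∀ a b, G.Adj a b → (a ∈ S ↔ b ∈ S)) : (G.induce S ⊕g G.induce Sᶜ) ≃g G where
  toEquiv := Equiv.Set.sumCompl S
  map_rel_iff' := by
    rintro (⟨a, ha⟩ | ⟨a, ha⟩) (⟨b, hb⟩ | ⟨b, hb⟩)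
    · simp
    · simpa using fun h => hb ((hS a b h).1 ha)
    · simpa using fun h => ha ((hS a b h).2 hb)
    · simp

/-- One component is split off; by `isGood_of_preconnected` it is good, K4 or K33, and induction
handles the rest. -/
theorem classified {V : Type*} [Fintype V] (G : SimpleGraph V) (hG : ∀ v, deg G v = 3)
    (hV : 0 < Fintype.card V) : Classified G := by
  induction hn : Fintype.card V using Nat.strong_induction_on generalizing V with
  | _ n ih =>
  subst hn
  obtain ⟨v⟩ := Fintype.card_pos_iff.1 hV
  have hconn : ∀ {W : Type _} [Fintype W] (K : SimpleGraph W), (∀ v, deg K v = 3) →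
      0 < Fintype.card W → K.Preconnected → IsGood K ∨ Nonempty (K ≃g graphK4) ∨
      Nonempty (K ≃g graphK33) := by
    intro W _ K hK hW hc
    by_contra h
    push Not at h
    exact h.1 (isGood_of_preconnected hK hc hW (by simpa using h.2.1) (by simpa using h.2.2))
  by_cases hpre : G.Preconnected
  · rcases hconn G hG hV hpre with h | h | h
    · exact .inl h
    · exact .inr (.inl h)
    · exact .inr (.inr (.inl h))
  let C := G.connectedComponentMk v
  have hS : ∀ a b, G.Adj a b → (a ∈ C.supp ↔ b ∈ C.supp) := fun a b hab =>
    C.mem_supp_congr_adj hab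
  let e := isoInduceSum G C.supp hS
  have hl : ∀ x, deg (G.induce C.supp) x = 3 := fun x => by
    rw [← deg_sum_inl (G' := G.induce C.suppᶜ), ← e.deg_eq, hG]
  have hr : ∀ x, deg (G.induce C.suppᶜ) x = 3 := fun x => by
    rw [← deg_sum_inr (G := G.induce C.supp), ← e.deg_eq, hG]
  have hcard := Fintype.card_congr e.toEquiv
  rw [Fintype.card_sum] at hcard
  have hvl : 0 < Fintype.card C.supp := Fintype.card_pos_iff.2 ⟨⟨v, rfl⟩⟩
  have hvr : 0 < Fintype.card ↑(C.suppᶜ) := by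
    refine Fintype.card_pos_iff.2 ?_
    by_contra h
    refine hpre fun a b => ?_
    have hall : ∀ a, a ∈ C.supp := fun a => by
      by_contra ha
      exact h ⟨⟨a, ha⟩⟩
    exact SimpleGraph.ConnectedComponent.exact ((hall a).trans (hall b).symm)
  have hind := ih _ (by omega) (G.induce C.suppᶜ) hr hvr rfl
  refine Classified.of_iso e.symm ?_
  rcases hconn (G.induce C.supp) hl hvl C.connected_toSimpleGraph.preconnected with h | ⟨⟨f⟩⟩ | ⟨⟨f⟩⟩
  · exact .inl (h.classified_sum hl hr hind)
  · exact hind.graphK4_sum.of_iso (.sumCongr f .refl)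
  · exact .inl ((hind.graphK33_sum hr).of_iso (.sumCongr f .refl))

theorem exists_realizes_balanced {V : Type*} [Fintype V] (G : SimpleGraph V)
    (hG : ∀ v, deg G v = 3) (hK4 : ¬ Nonempty (G ≃g graphK4)) (hK33 : ¬ Nonempty (G ≃g graphK33))
    (h3K4 : ¬ Nonempty (G ≃g graphThreeK4)) :
    ∃ q m : ℕ, (m = q ∨ m = q + 1) ∧ Realizes G m q m q := by
  rcases Nat.eq_zero_or_pos (Fintype.card V) with h0 | hV
  · have hz : ∀ k, vertexCount G k = 0 := fun k => by
      have := Fintype.card_eq_zero_iff.1 h0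
      rw [vertexCount_eq, univ_eq_empty]
      rfl
    exact ⟨0, 0, by simp, G, le_rfl, hz 0, hz 1, hz 2, hz 3⟩
  rcases classified G hG hV with ⟨q, m, hm, h, -⟩ | h | h | ⟨⟨f⟩⟩ | h
  · exact ⟨q, m, hm, h⟩
  · exact absurd h hK4
  · exact absurd h hK33
  -- Two copies of K4 are not known to be good, yet complementary choices in them balance.
  · exact ⟨2, 2, by simp, (graphK4_realizes_2200.sum graphK4_realizes_0022).of_iso f⟩
  · exact absurd h h3K4

theorem vertexCount_le_maxVertexCount {V : Type*} [Fintype V] (H : SimpleGraph V) (k : ℕ) :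
    vertexCount H k ≤ maxVertexCount H := by
  rcases Nat.eq_zero_or_pos (vertexCount H k) with h | h
  · omega
  obtain ⟨v, hv⟩ := exists_of_vertexCount_pos h
  rw [← hv]
  exact le_sup (f := fun v : V => vertexCount H (deg H v)) (mem_univ v)

theorem maxVertexCount_le {V : Type*} [Fintype V] {G H : SimpleGraph V}
    (hG : ∀ v, deg G v = 3) (hH : H ≤ G) {m : ℕ} (h : ∀ k ≤ 3, vertexCount H k ≤ m) :
    maxVertexCount H ≤ m :=
  Finset.sup_le fun v _ => h _ (deg_le_three hG hH v)

end Classification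

theorem theorem1 {V : Type*} [Fintype V] (G : SimpleGraph V) [DecidableRel G.Adj]
    (hG : G.IsRegularOfDegree 3)
    (hK4 : ¬ Nonempty (G ≃g graphK4))
    (hK33 : ¬ Nonempty (G ≃g graphK33))
    (h3K4 : ¬ Nonempty (G ≃g graphThreeK4)) :
    (∃ H : SimpleGraph V, H ≤ G ∧
      (∀ k : ℕ, k ≤ 3 →
        vertexCount H k = ⌊(Fintype.card V : ℚ) / 4⌋₊ ∨
        vertexCount H k = ⌈(Fintype.card V : ℚ) / 4⌉₊) ∧
      maxVertexCount H = ⌈(Fintype.card V : ℚ) / 4⌉₊) ∧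
    (∀ H' : SimpleGraph V, H' ≤ G →
      ⌈(Fintype.card V : ℚ) / 4⌉₊ ≤ maxVertexCount H') := by
  have hd : ∀ v, deg G v = 3 := fun v => (deg_eq_degree G v).trans (hG v)
  have lower : ∀ H' : SimpleGraph V, H' ≤ G →
      ⌈(Fintype.card V : ℚ) / 4⌉₊ ≤ maxVertexCount H' := by
    intro H' hH'
    have hs := sum_vertexCount hd hH'
    have h0 := vertexCount_le_maxVertexCount H' 0
    have h1 := vertexCount_le_maxVertexCount H' 1
    have h2 := vertexCount_le_maxVertexCount H' 2
    have h3 := vertexCount_le_maxVertexCount H' 3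
    have : (Fintype.card V : ℚ) ≤ 4 * maxVertexCount H' := by
      exact_mod_cast (by omega : Fintype.card V ≤ 4 * maxVertexCount H')
    rw [Nat.ceil_le]
    linarith
  refine ⟨?_, lower⟩
  obtain ⟨q, m, hm, H, hH, h0, h1, h2, h3⟩ := exists_realizes_balanced G hd hK4 hK33 h3K4
  have hcard : Fintype.card V = 2 * q + 2 * m := by
    have := sum_vertexCount hd hH
    omega
  -- The quotient n/4 is q or q + 1/2.
  have hfloor : ⌊(Fintype.card V : ℚ) / 4⌋₊ = q := by
    rw [Nat.floor_eq_iff (by positivity), hcard]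
    rcases hm with rfl | rfl <;> push_cast <;> constructor <;> linarith
  have hceil : m ≤ ⌈(Fintype.card V : ℚ) / 4⌉₊ := by
    by_contra h
    have h' : ⌈(Fintype.card V : ℚ) / 4⌉₊ ≤ m - 1 := by omega
    rw [Nat.ceil_le] at h'
    have hm1 : ((m - 1 : ℕ) : ℚ) + 1 = m := by exact_mod_cast (by omega : m - 1 + 1 = m)
    have hq : (m : ℚ) ≤ q + 1 := by exact_mod_cast (by omega : m ≤ q + 1)
    rw [hcard] at h'
    push_cast at h'
    linarith
  have hcounts : ∀ k ≤ 3, vertexCount H k = q ∨ vertexCount H k = m := by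
    intro k hk
    interval_cases k <;> simp [*]
  have hmax : maxVertexCount H ≤ m := maxVertexCount_le hd hH fun k hk => by
    have := hcounts k hk
    omega
  have hceil' : ⌈(Fintype.card V : ℚ) / 4⌉₊ = m := le_antisymm ((lower H hH).trans hmax) hceil
  rw [hfloor, hceil']
  exact ⟨H, hH, hcounts, le_antisymm hmax (hceil' ▸ lower H hH)⟩
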